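/- **Conventions.** An *operator space* is a complex vector space $X$ with norms on all matrix spaces $M_{m,n}(X)$ such that $\|x\oplus y\|=\max\{\|x\|,\|y\|\}$ and $\|\alpha x\beta\|\le\|\alpha\|\,\|x\|\,\|\beta\|$ for scalar matrices $\alpha,\beta$ of suitable sizes (carrying the operator norm). Let $C_2(X)=M_{2,1}(X)$ and $R_2(X)=M_{1,2}(X)$ with the operator space structures $M_n(C_2(X))=M_{2n,n}(X)$ and $M_n(R_2(X))=M_{n,2n}(X)$, and let $C_2[X]=C_2(\mathbb C)\,\hat\otimes\,X$ and $R_2[X]=R_2(\mathbb C)\,\hat\otimes\,X$ be the projective operator space tensor products, where $\|u\|=\inf\{\|\alpha\|\|x\|\|y\|\|\beta\| : u=\alpha(x\otimes y)\beta\}$ for a matrix $u$ over $X\otimes Y$, with $x$ and $y$ matrices over $X$ and $Y$ and $\alpha,\beta$ scalar matrices. For a linear map $P:X\to X$ with $P^2=P$ let $\nu_P(x)=(Px,\,x-Px)$. Then $P$ is a *left $M$-*, *right $M$-*, *left $L$-* or *right $L$-projection* if $\nu_P$ is an isometry of $X$ into $C_2(X)$, $R_2(X)$, $C_2[X]$ or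 $R_2[X]$, respectively. $P$ is a *complete* left (right) $M$-projection if for every $n$ its entrywise amplification $P_n:M_n(X)\to M_n(X)$ is a left (right) $M$-projection, and a *complete* left (right) $L$-projection if $\nu_P:X\to C_2[X]$ (respectively $\nu_P:X\to R_2[X]$) is a complete isometry. Let $H$ be a complex Hilbert space, with the following operator space structures: $H_c=B(\mathbb C,H)$ (column); $H_r=B(H^*,\mathbb C)$ (row); Pisier's self-dual $H_o$, where $\|[x_{ij}]\|=\big\|[\langle x_{ij},x_{kl}\rangle]_{(i,k),(j,l)}\big\|^{1/2}$; $MIN(H)$, where $\|[x_{ij}]\|=\sup\{\|[f(x_{ij})]\| : f\in H^*,\ \|f\|\le 1\}$; and $MAX(H)$, whose matrix norms are the suprema of the matrix norms over all operator space structures on $H$ with the given norm on $H=M_1(H)$. Let $I$ be the identity on $H$ and let $\mathrm{Proj}(B(H))$ be the set of orthogonal projections on $H$. **Proposition.** The sets of all one-sided $M$- and $L$-projections of these operator spaces are $$\begin{array}{l|c|c|c|c} & \text{left } M & \text{right } L & \text{right } M & \text{left } L\\ \hline H_c & \mathrm{Proj}(B(H)) & \{0,I\} & \{0,I\} & \mathrm{Proj}(B(H))\\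 H_r & \{0,I\} & \mathrm{Proj}(B(H)) & \mathrm{Proj}(B(H)) & \{0,I\}\\ H_o & \{0,I\} & \{0,I\} & \{0,I\} & \{0,I\}\\ MIN(H) & \{0,I\} & \mathrm{Proj}(B(H)) & \{0,I\} & \mathrm{Proj}(B(H))\\ MAX(H) & \mathrm{Proj}(B(H)) & \{0,I\} & \mathrm{Proj}(B(H)) & \{0,I\} \end{array}$$ The rows of $H_c$, $H_r$ and $H_o$ are also valid for the complete one-sided $M$- and $L$-projections. However, the complete left $M$-projections of $MAX(H)$ are only $0$ and $I$, and so are its complete right $M$-projections; the complete left $L$-projections of $MIN(H)$ are only $0$ and $I$, and so are its complete right $L$-projections. -/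

import Mathlib

open scoped TensorProduct

noncomputable section

/-! ### Matrix norms and operator spaces -/

/-- The norm of a rectangular scalar matrix, as an operator between Euclidean spaces. -/
def scalarOpNorm {m n : Type} [Fintype m] [Fintype n] (A : Matrix m n ℂ) : ℝ :=
  letI : DecidableEq n := Classical.decEq n
  ‖Matrix.toEuclideanLin.trans LinearMap.toContinuousLinearMap A‖

/-- A system of real-valued functions on all the rectangular matrix spaces `M_{m,n}(X)`
(with arbitrary finite index sets). -/
structure MatrixNorms (X : Type*) where
  nrm : ∀ {m n : Type} [Fintype m] [Fintype n], Matrix m n X → ℝ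

/-- The two-sided action `α x β` of scalar matrices on a matrix over a vector space. -/
def Matrix.bimul {X : Type*} [AddCommGroup X] [Module ℂ X] {p m n q : Type}
    [Fintype m] [Fintype n] (α : Matrix p m ℂ) (x : Matrix m n X) (β : Matrix n q ℂ) :
    Matrix p q X :=
  Matrix.of fun i j => ∑ k, ∑ l, (α i k * β l j) • x k l

/-- The matrix of elementary tensors `x ⊗ y`, with rows and columns indexed by pairs. -/
def Matrix.tensorMat {X Y : Type*} [AddCommGroup X] [Module ℂ X] [AddCommGroup Y] [Module ℂ Y]
    {p q r s : Type} (x : Matrix p q X) (y : Matrix r s Y) :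
    Matrix (p × r) (q × s) (X ⊗[ℂ] Y) :=
  Matrix.of fun i j => x i.1 j.1 ⊗ₜ[ℂ] y i.2 j.2

/-- The operator `[T i j] : K^n → L^m` defined by a matrix of operators, where `K^n` and `L^m`
are the `ℓ²`-direct sums. -/
def operatorMatrix {K L : Type*} [NormedAddCommGroup K] [NormedSpace ℂ K]
    [NormedAddCommGroup L] [NormedSpace ℂ L] {m n : Type} [Fintype m] [Fintype n]
    (T : Matrix m n (K →L[ℂ] L)) :
    PiLp 2 (fun _ : n => K) →L[ℂ] PiLp 2 (fun _ : m => L) :=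
  (PiLp.continuousLinearEquiv 2 ℂ (fun _ : m => L)).symm.toContinuousLinearMap ∘L
    ContinuousLinearMap.pi fun i => ∑ j, T i j ∘L PiLp.proj 2 (fun _ : n => K) j

namespace MatrixNorms

/-- The norm of an element of `X`, regarded as a `1 × 1` matrix. -/
def one {X : Type*} (o : MatrixNorms X) (x : X) : ℝ :=
  o.nrm (Matrix.of fun (_ _ : Unit) => x)

/-- The axioms of an operator space: every `M_{m,n}(X)` is normed, the norm of a diagonal direct
sum is the maximum of the norms, and the scalar matrices act contractively. (As `α` and `β` may be
rectangular, the square matrix norms determine all the others, and conversely a system of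
square matrix norms with these properties extends to the rectangular matrices.) -/
structure IsOperatorSpace {X : Type*} [AddCommGroup X] [Module ℂ X] (o : MatrixNorms X) :
    Prop where
  add_le : ∀ {m n : Type} [Fintype m] [Fintype n] (x y : Matrix m n X),
    o.nrm (x + y) ≤ o.nrm x + o.nrm y
  smul_eq : ∀ {m n : Type} [Fintype m] [Fintype n] (c : ℂ) (x : Matrix m n X),
    o.nrm (c • x) = ‖c‖ * o.nrm x
  eq_zero : ∀ {m n : Type} [Fintype m] [Fintype n] (x : Matrix m n X),
    o.nrm x = 0 → x = 0
  directSum : ∀ {m n p q : Type} [Fintype m] [Fintype n] [Fintype p] [Fintype q]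
    (x : Matrix m n X) (y : Matrix p q X),
    o.nrm (Matrix.fromBlocks x 0 0 y) = max (o.nrm x) (o.nrm y)
  bimul_le : ∀ {p m n q : Type} [Fintype p] [Fintype m] [Fintype n] [Fintype q]
    (α : Matrix p m ℂ) (x : Matrix m n X) (β : Matrix n q ℂ),
    o.nrm (Matrix.bimul α x β) ≤ scalarOpNorm α * o.nrm x * scalarOpNorm β

/-- The matrix norms on `X` coming from a map of `X` into the bounded operators `K → L`. -/
def concrete {X K L : Type*} [NormedAddCommGroup K] [NormedSpace ℂ K]
    [NormedAddCommGroup L] [NormedSpace ℂ L] (σ : X → (K →L[ℂ] L)) : MatrixNorms X where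
  nrm x := ‖operatorMatrix (x.map σ)‖

/-- The scalars `ℂ` with their standard matrix norms. -/
def scalars : MatrixNorms ℂ where
  nrm x := scalarOpNorm x

/-! ### Constructions: `M_n(X)`, `C₂(X)`, `R₂(X)`, projective tensor products, `C₂[X]`, `R₂[X]` -/

/-- The operator space `M_n(X)`: a matrix of matrices is regarded as one large matrix. -/
def amplify {X : Type*} (o : MatrixNorms X) (n : ℕ) : MatrixNorms (Matrix (Fin n) (Fin n) X) where
  nrm {m k} _ _ x := o.nrm (Matrix.comp m k (Fin n) (Fin n) X x)

/-- The operator space `C₂(X)` of columns of length two: a matrix of columns is regarded as a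
matrix over `X` with twice as many rows. -/
def col {X : Type*} (o : MatrixNorms X) : MatrixNorms (Fin 2 → X) where
  nrm {m n} _ _ x := o.nrm (Matrix.of fun (i : m × Fin 2) (j : n) => x i.1 j i.2)

/-- The operator space `R₂(X)` of rows of length two: a matrix of rows is regarded as a
matrix over `X` with twice as many columns. -/
def row {X : Type*} (o : MatrixNorms X) : MatrixNorms (Fin 2 → X) where
  nrm {m n} _ _ x := o.nrm (Matrix.of fun (i : m) (j : n × Fin 2) => x i j.1 j.2)

/-- The projective operator space tensor norms on `X ⊗ Y`: the infimum of
`‖α‖ ‖x‖ ‖y‖ ‖β‖` over all the factorizations `u = α (x ⊗ y) β`. -/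
def proj {X Y : Type*} [AddCommGroup X] [Module ℂ X] [AddCommGroup Y] [Module ℂ Y]
    (oX : MatrixNorms X) (oY : MatrixNorms Y) : MatrixNorms (X ⊗[ℂ] Y) where
  nrm {m n} _ _ u := sInf {t : ℝ | ∃ (p q r s : ℕ) (α : Matrix m (Fin p × Fin r) ℂ)
    (x : Matrix (Fin p) (Fin q) X) (y : Matrix (Fin r) (Fin s) Y)
    (β : Matrix (Fin q × Fin s) n ℂ),
    u = Matrix.bimul α (Matrix.tensorMat x y) β ∧
      t = scalarOpNorm α * oX.nrm x * oY.nrm y * scalarOpNorm β}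

/-- The identification of `X ⊕ X` with `ℂ² ⊗ X`. -/
def toTensor {X : Type*} [AddCommGroup X] [Module ℂ X] (v : Fin 2 → X) : (Fin 2 → ℂ) ⊗[ℂ] X :=
  ∑ k, (Pi.single k 1 : Fin 2 → ℂ) ⊗ₜ[ℂ] v k

/-- The operator space `C₂[X]`, the projective tensor product of `C₂ = C₂(ℂ)` and `X`. -/
def colProj {X : Type*} [AddCommGroup X] [Module ℂ X] (o : MatrixNorms X) :
    MatrixNorms (Fin 2 → X) where
  nrm x := (proj (col scalars) o).nrm (x.map toTensor)

/-- The operator space `R₂[X]`, the projective tensor product of `R₂ = R₂(ℂ)` and `X`. -/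
def rowProj {X : Type*} [AddCommGroup X] [Module ℂ X] (o : MatrixNorms X) :
    MatrixNorms (Fin 2 → X) where
  nrm x := (proj (row scalars) o).nrm (x.map toTensor)

/-- A map is a complete isometry if all its entrywise amplifications preserve the norm. -/
def IsCompleteIsometry {X Y : Type*} (oX : MatrixNorms X) (oY : MatrixNorms Y) (φ : X → Y) :
    Prop :=
  ∀ (n : ℕ) (x : Matrix (Fin n) (Fin n) X), oY.nrm (x.map φ) = oX.nrm x

/-! ### One-sided `M`- and `L`-projections -/

/-- The map `x ↦ (P x, x - P x)`. -/
def splitMap {X : Type*} [AddCommGroup X] [Module ℂ X] (P : X →ₗ[ℂ] X) (x : X) : Fin 2 → X :=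
  ![P x, x - P x]

section Projections

variable {X : Type*} [AddCommGroup X] [Module ℂ X] (o : MatrixNorms X)

/-- The left `M`-projections. -/
def leftM : Set (X →ₗ[ℂ] X) :=
  {P | P ∘ₗ P = P ∧ ∀ x, o.one x = o.col.one (splitMap P x)}

/-- The right `M`-projections. -/
def rightM : Set (X →ₗ[ℂ] X) :=
  {P | P ∘ₗ P = P ∧ ∀ x, o.one x = o.row.one (splitMap P x)}

/-- The left `L`-projections. -/
def leftL : Set (X →ₗ[ℂ] X) :=
  {P | P ∘ₗ P = P ∧ ∀ x, o.one x = o.colProj.one (splitMap P x)}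

/-- The right `L`-projections. -/
def rightL : Set (X →ₗ[ℂ] X) :=
  {P | P ∘ₗ P = P ∧ ∀ x, o.one x = o.rowProj.one (splitMap P x)}

/-- The complete left `M`-projections: every entrywise amplification `P_n` is a left
`M`-projection of `M_n(X)`. -/
def completeLeftM : Set (X →ₗ[ℂ] X) :=
  {P | ∀ n : ℕ, P.mapMatrix ∈ (o.amplify n).leftM}

/-- The complete right `M`-projections: every entrywise amplification `P_n` is a right
`M`-projection of `M_n(X)`. -/
def completeRightM : Set (X →ₗ[ℂ] X) :=
  {P | ∀ n : ℕ, P.mapMatrix ∈ (o.amplify n).rightM}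

/-- The complete left `L`-projections. -/
def completeLeftL : Set (X →ₗ[ℂ] X) :=
  {P | P ∘ₗ P = P ∧ IsCompleteIsometry o o.colProj (splitMap P)}

/-- The complete right `L`-projections. -/
def completeRightL : Set (X →ₗ[ℂ] X) :=
  {P | P ∘ₗ P = P ∧ IsCompleteIsometry o o.rowProj (splitMap P)}

end Projections

/-! ### The quantizations of a Hilbert space -/

section Hilbert

variable (H : Type*) [NormedAddCommGroup H] [InnerProductSpace ℂ H]

/-- The column Hilbert space `H_c = B(ℂ, H)`. -/
def columnHilbert : MatrixNorms H :=
  concrete fun ξ : H => ContinuousLinearMap.toSpanSingleton ℂ ξ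

/-- The row Hilbert space `H_r = B(H*, ℂ)`. -/
def rowHilbert : MatrixNorms H :=
  concrete fun ξ : H => NormedSpace.inclusionInDoubleDual ℂ H ξ

/-- Pisier's self-dual operator Hilbert space `H_o`, with
`‖[x i j]‖ = ‖[⟪x i j, x k l⟫]‖ ^ (1/2)`, rows indexed by `(i, k)` and columns by `(j, l)`. -/
def operatorHilbert : MatrixNorms H where
  nrm {m n} _ _ x := Real.sqrt (scalarOpNorm
    (Matrix.of fun (i : m × m) (j : n × n) => inner ℂ (x i.1 j.1) (x i.2 j.2)))

/-- `MIN(H)`: the matrix norms given by the contractive functionals. -/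
def minHilbert : MatrixNorms H where
  nrm x := sSup {t : ℝ | ∃ f : StrongDual ℂ H, ‖f‖ ≤ 1 ∧ t = scalarOpNorm (x.map f)}

/-- `MAX(H)`: the largest operator space structure whose norm on `H` is the given one. -/
def maxHilbert : MatrixNorms H where
  nrm x := sSup {t : ℝ | ∃ o : MatrixNorms H,
    o.IsOperatorSpace ∧ (∀ ξ, o.one ξ = ‖ξ‖) ∧ t = o.nrm x}

/-- `Proj(B(H))`, the orthogonal projections on `H`. -/
def orthProj [CompleteSpace H] : Set (H →ₗ[ℂ] H) :=
  {P | ∃ p : H →L[ℂ] H, IsStarProjection p ∧ (p : H →ₗ[ℂ] H) = P}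

/-- The set `{0, I}`. -/
def trivialProj : Set (H →ₗ[ℂ] H) := {0, LinearMap.id}

end Hilbert

end MatrixNorms

end

/-! Passing to the opposite structure (transposing all matrices) exchanges left and right, exchanges
`H_c` with `H_r`, and fixes `H_o`, `MIN(H)` and `MAX(H)`. So only left projections need be treated.

Upper inclusion: the coordinate maps of `C₂(X)` and `C₂[X]` are contractive, so a left projection is
a contractive idempotent on `H`, hence an orthogonal projection. If it is neither `0` nor `I`, there
are orthonormal `u` in its range and `v` in its kernel, and it sends `u + v`, of norm `√2`, to the
pair `(u, v)`. Every `{0, I}` entry of the table therefore follows once `(u, v)` has norm different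
from `√2`. In `C₂(X)` this norm is at most `1` for `H_r` and `MIN(H)` and at most `2^(1/4)` for
`H_o`. In `C₂[X]` it is bounded below by pairing with `⟪u, ·⟫` and `⟪v, ·⟫`, which gives at least
`2` for `H_r` and `MAX(H)` and at least `2^(3/4)` for `H_o`.

Lower inclusion: on `H_c` the left `M` case is Pythagoras' theorem, and the left `L` case combines
an explicit factorization through orthonormal bases (`colProj_splitMap_le`) with the contraction
`(a, b) ↦ P a + (b - P b)`. Since `MIN(H)` is dominated by `H_c`, the same factorization serves for
it, and the pair of functionals `⟪P x, ·⟫`, `⟪x - P x, ·⟫` gives the reverse estimate. For `MAX(H)`,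
which dominates `H_c`, a column `(a, b)` is a scalar column times a diagonal of unit vectors, so its
norm is at most `√(‖a‖² + ‖b‖²)`.

Completeness fails for nontrivial `P` already on 2 × 2 matrices. In `MAX(H)` the row `[u v]` has
norm at least `√2`, but splitting turns it into a permuted `diag(u, v)`, of norm at most `1`. In
`MIN(H)` the column with entries `u, v` has norm at most `1`, but its splitting has norm at least
`√2`, because `C₂[MIN(H)]` maps completely contractively to a column Hilbert space by `e_k ⊗ x ↦
⟪u_k, x⟫ e_k`, where `(u_0, u_1) = (u, v)`.

Most of the argument uses only the fragment `Regular` of the axioms, so the triangle inequality is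
never needed for `H_o`, `MIN(H)` or `MAX(H)`. -/

namespace MatrixNorms

/-! ### Matrices over the column Hilbert space as operators -/

section Column

variable {K : Type*} [NormedAddCommGroup K] [InnerProductSpace ℂ K]

theorem operatorMatrix_columnHilbert_apply {m n : Type} [Fintype m] [Fintype n]
    (x : Matrix m n K) (v : PiLp 2 (fun _ : n => ℂ)) (i : m) :
    operatorMatrix (x.map fun ξ : K => ContinuousLinearMap.toSpanSingleton ℂ ξ) v i =
      ∑ j, v j • x i j := by
  simp [operatorMatrix]

theorem columnHilbert_nonneg {m n : Type} [Fintype m] [Fintype n] (x : Matrix m n K) :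
    0 ≤ (columnHilbert K).nrm x :=
  ContinuousLinearMap.opNorm_nonneg _

theorem columnHilbert_bound {m n : Type} [Fintype m] [Fintype n] (x : Matrix m n K)
    (v : n → ℂ) :
    ∑ i, ‖∑ j, v j • x i j‖ ^ 2 ≤ (columnHilbert K).nrm x ^ 2 * ∑ j, ‖v j‖ ^ 2 := by
  have h := ContinuousLinearMap.le_opNorm
    (operatorMatrix (x.map fun ξ : K => ContinuousLinearMap.toSpanSingleton ℂ ξ)) (WithLp.toLp 2 v)
  have h2 := pow_le_pow_left₀ (norm_nonneg _) h 2
  rw [mul_pow, PiLp.norm_sq_eq_of_L2, PiLp.norm_sq_eq_of_L2] at h2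
  simp only [operatorMatrix_columnHilbert_apply] at h2
  exact h2

theorem columnHilbert_le {m n : Type} [Fintype m] [Fintype n] {x : Matrix m n K} {C : ℝ}
    (hC : 0 ≤ C)
    (h : ∀ v : n → ℂ, ∑ i, ‖∑ j, v j • x i j‖ ^ 2 ≤ C ^ 2 * ∑ j, ‖v j‖ ^ 2) :
    (columnHilbert K).nrm x ≤ C := by
  refine ContinuousLinearMap.opNorm_le_bound _ hC fun v => ?_
  refine le_of_sq_le_sq ?_ (by positivity)
  rw [mul_pow, PiLp.norm_sq_eq_of_L2, PiLp.norm_sq_eq_of_L2]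
  simpa only [operatorMatrix_columnHilbert_apply] using h v

theorem columnHilbert_le_of_forall_le {K' : Type*} [NormedAddCommGroup K']
    [InnerProductSpace ℂ K'] {m m' n : Type} [Fintype m] [Fintype m'] [Fintype n]
    {x : Matrix m n K} {y : Matrix m' n K'}
    (h : ∀ v : n → ℂ, ∑ i, ‖∑ j, v j • x i j‖ ^ 2 ≤ ∑ i, ‖∑ j, v j • y i j‖ ^ 2) :
    (columnHilbert K).nrm x ≤ (columnHilbert K').nrm y :=
  columnHilbert_le (columnHilbert_nonneg y) fun v => (h v).trans (columnHilbert_bound y v)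

end Column

/-- Scalar matrices become a special case of matrices of vectors, so bounds proved for column
Hilbert spaces apply to `scalarOpNorm`. -/
theorem scalars_eq_columnHilbert : scalars = columnHilbert ℂ := by
  have key : ∀ {m n : Type} [Fintype m] [Fintype n] (A : Matrix m n ℂ)
      (v : PiLp 2 (fun _ : n => ℂ)) (i : m),
      (letI : DecidableEq n := Classical.decEq n
      Matrix.toEuclideanLin.trans LinearMap.toContinuousLinearMap A) v i = ∑ j, v j • A i j := by
    intro m n _ _ A v i
    simp [Matrix.toLpLin_apply, Matrix.mulVec, dotProduct, mul_comm]
  refine congrArg MatrixNorms.mk ?_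
  funext m n _ _ A
  refine congrArg norm (α := PiLp 2 (fun _ : n => ℂ) →L[ℂ] PiLp 2 (fun _ : m => ℂ)) ?_
  ext v i
  rw [key, operatorMatrix_columnHilbert_apply]

end MatrixNorms

open MatrixNorms

/-! ### Norms of scalar matrices -/

section Scalar

theorem scalarOpNorm_eq {m n : Type} [Fintype m] [Fintype n] (A : Matrix m n ℂ) :
    scalarOpNorm A = (columnHilbert ℂ).nrm A := by
  rw [← scalars_eq_columnHilbert]; rfl

theorem scalarOpNorm_nonneg {m n : Type} [Fintype m] [Fintype n] (A : Matrix m n ℂ) :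
    0 ≤ scalarOpNorm A := norm_nonneg _

theorem scalarOpNorm_bound {m n : Type} [Fintype m] [Fintype n] (A : Matrix m n ℂ)
    (v : n → ℂ) :
    ∑ i, ‖∑ j, A i j * v j‖ ^ 2 ≤ scalarOpNorm A ^ 2 * ∑ j, ‖v j‖ ^ 2 := by
  simpa only [smul_eq_mul, mul_comm, scalarOpNorm_eq] using columnHilbert_bound A v

theorem scalarOpNorm_le {m n : Type} [Fintype m] [Fintype n] {A : Matrix m n ℂ} {C : ℝ}
    (hC : 0 ≤ C)
    (h : ∀ v : n → ℂ, ∑ i, ‖∑ j, A i j * v j‖ ^ 2 ≤ C ^ 2 * ∑ j, ‖v j‖ ^ 2) :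
    scalarOpNorm A ≤ C := by
  rw [scalarOpNorm_eq]
  exact columnHilbert_le hC (by simpa only [smul_eq_mul, mul_comm] using h)

/-- The bilinear form of a scalar matrix is bounded by its norm. -/
theorem norm_sum_mul_le_scalarOpNorm {m n : Type} [Fintype m] [Fintype n] (A : Matrix m n ℂ)
    (w : m → ℂ) (v : n → ℂ) :
    ‖∑ i, w i * ∑ j, A i j * v j‖ ≤
      √(∑ i, ‖w i‖ ^ 2) * (scalarOpNorm A * √(∑ j, ‖v j‖ ^ 2)) := by
  calc ‖∑ i, w i * ∑ j, A i j * v j‖ ≤ ∑ i, ‖w i‖ * ‖∑ j, A i j * v j‖ := by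
        refine (norm_sum_le _ _).trans_eq ?_
        simp only [norm_mul]
    _ ≤ √(∑ i, ‖w i‖ ^ 2) * √(∑ i, ‖∑ j, A i j * v j‖ ^ 2) :=
        Real.sum_mul_le_sqrt_mul_sqrt _ _ _
    _ ≤ _ := by
        gcongr
        refine (Real.sqrt_le_sqrt (scalarOpNorm_bound A v)).trans_eq ?_
        rw [Real.sqrt_mul (sq_nonneg _), Real.sqrt_sq (scalarOpNorm_nonneg A)]

/-- With `h = Aᵀ w` one has `‖h‖² = ∑ w_i (A h̄)_i ≤ ‖w‖ ‖A‖ ‖h‖`, and a factor `‖h‖` cancels. -/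
theorem scalarOpNorm_transpose_le {m n : Type} [Fintype m] [Fintype n] (A : Matrix m n ℂ) :
    scalarOpNorm A.transpose ≤ scalarOpNorm A := by
  refine scalarOpNorm_le (scalarOpNorm_nonneg A) fun w => ?_
  set h : n → ℂ := fun j => ∑ i, A.transpose j i * w i with hh
  have h1 : ((∑ j, ‖h j‖ ^ 2 : ℝ) : ℂ) = ∑ i, w i * ∑ j, A i j * starRingEnd ℂ (h j) := by
    simp only [Finset.mul_sum]
    rw [Finset.sum_comm]
    push_cast
    refine Finset.sum_congr rfl fun j _ => ?_
    rw [← Complex.mul_conj', show h j = ∑ i, A.transpose j i * w i from rfl]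
    simp only [Finset.sum_mul, Matrix.transpose_apply]
    exact Finset.sum_congr rfl fun i _ => by ring
  have h2 := norm_sum_mul_le_scalarOpNorm A w fun j => starRingEnd ℂ (h j)
  rw [← h1, Complex.norm_real, Real.norm_of_nonneg (by positivity)] at h2
  simp only [RCLike.norm_conj] at h2
  set S := ∑ j, ‖h j‖ ^ 2
  have hS : 0 ≤ S := by positivity
  have hW : 0 ≤ ∑ i, ‖w i‖ ^ 2 := by positivity
  change S ≤ _
  have h3 : √S ≤ √(∑ i, ‖w i‖ ^ 2) * scalarOpNorm A := by
    by_contra! hlt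
    have hpos : 0 < √S := lt_of_le_of_lt (by have := scalarOpNorm_nonneg A; positivity) hlt
    nlinarith [Real.mul_self_sqrt hS]
  calc S = √S ^ 2 := (Real.sq_sqrt hS).symm
    _ ≤ (√(∑ i, ‖w i‖ ^ 2) * scalarOpNorm A) ^ 2 := by gcongr
    _ = _ := by rw [mul_pow, Real.sq_sqrt hW, mul_comm]

theorem scalarOpNorm_transpose {m n : Type} [Fintype m] [Fintype n] (A : Matrix m n ℂ) :
    scalarOpNorm A.transpose = scalarOpNorm A :=
  le_antisymm (scalarOpNorm_transpose_le A) (scalarOpNorm_transpose_le A.transpose)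

theorem scalarOpNorm_map_conj_le {m n : Type} [Fintype m] [Fintype n] (A : Matrix m n ℂ) :
    scalarOpNorm (A.map (starRingEnd ℂ)) ≤ scalarOpNorm A := by
  refine scalarOpNorm_le (scalarOpNorm_nonneg A) fun v => ?_
  have h := scalarOpNorm_bound A fun j => starRingEnd ℂ (v j)
  simp only [RCLike.norm_conj] at h
  refine le_of_eq_of_le (Finset.sum_congr rfl fun i _ => ?_) h
  rw [← RCLike.norm_conj]
  simp

theorem scalarOpNorm_of_const {m n : Type} [Fintype m] [Fintype n] [Unique m] [Unique n]
    (c : ℂ) : scalarOpNorm (Matrix.of fun (_ : m) (_ : n) => c) = ‖c‖ := by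
  refine le_antisymm (scalarOpNorm_le (norm_nonneg _) fun v => ?_) ?_
  · simp [mul_pow]
  · have := scalarOpNorm_bound (Matrix.of fun (_ : m) (_ : n) => c) fun _ => 1
    simp only [Finset.univ_unique, Matrix.of_apply, mul_one, Finset.sum_singleton, norm_one,
      one_pow] at this
    exact le_of_sq_le_sq this (scalarOpNorm_nonneg _)

/-- The selection matrix of a map between index sets. -/
def selMatrix {p m : Type} [DecidableEq m] (f : p → m) : Matrix p m ℂ :=
  Matrix.of fun i k => if f i = k then 1 else 0

theorem scalarOpNorm_selMatrix_le {p m : Type} [Fintype p] [Fintype m] [DecidableEq m]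
    {f : p → m} (hf : Function.Injective f) : scalarOpNorm (selMatrix f) ≤ 1 := by
  refine scalarOpNorm_le zero_le_one fun v => ?_
  simp only [selMatrix, Matrix.of_apply, ite_mul, one_mul, zero_mul, Finset.sum_ite_eq,
    Finset.mem_univ, if_true, one_pow]
  calc ∑ i, ‖v (f i)‖ ^ 2 = ∑ k ∈ Finset.univ.map ⟨f, hf⟩, ‖v k‖ ^ 2 := by simp
    _ ≤ _ := Finset.sum_le_sum_of_subset_of_nonneg (Finset.subset_univ _)
      fun _ _ _ => by positivity

theorem scalarOpNorm_selMatrix_transpose_le {p m : Type} [Fintype p] [Fintype m]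
    [DecidableEq m] {f : p → m} (hf : Function.Injective f) :
    scalarOpNorm (selMatrix f).transpose ≤ 1 :=
  (scalarOpNorm_transpose _).trans_le (scalarOpNorm_selMatrix_le hf)

theorem scalarOpNorm_one_le {m : Type} [Fintype m] [DecidableEq m] :
    scalarOpNorm (1 : Matrix m m ℂ) ≤ 1 := by
  refine le_of_eq_of_le (congrArg scalarOpNorm ?_)
    (scalarOpNorm_selMatrix_le (Function.injective_id (α := m)))
  ext i j
  simp [selMatrix, Matrix.one_apply]

end Scalar

namespace MatrixNorms

/-! ### The column Hilbert space is an operator space -/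

section Column

variable {K : Type*} [NormedAddCommGroup K] [InnerProductSpace ℂ K]

/-- Parseval's identity on the span of a finite family. -/
theorem exists_orthonormal_span {ι : Type*} [Finite ι] (y : ι → K) :
    ∃ (d : ℕ) (b : Fin d → K), Orthonormal ℂ b ∧
      (∀ k, b k ∈ Submodule.span ℂ (Set.range y)) ∧
      ∀ z ∈ Submodule.span ℂ (Set.range y), z = ∑ k, inner ℂ (b k) z • b k := by
  have : FiniteDimensional ℂ (Submodule.span ℂ (Set.range y)) :=
    FiniteDimensional.span_of_finite ℂ (Set.finite_range y)
  let b := stdOrthonormalBasis ℂ (Submodule.span ℂ (Set.range y))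
  refine ⟨_, fun k => (b k : K), ?_, fun k => (b k).2, fun z hz => ?_⟩
  · exact b.orthonormal.comp_linearIsometry (Submodule.subtypeₗᵢ _)
  · have := congrArg Subtype.val (b.sum_repr' ⟨z, hz⟩)
    simpa using this.symm

theorem norm_sq_sum_smul_of_orthonormal {ι : Type*} [Fintype ι] {b : ι → K}
    (hb : Orthonormal ℂ b) (c : ι → ℂ) : ‖∑ k, c k • b k‖ ^ 2 = ∑ k, ‖c k‖ ^ 2 := by
  have h := hb.inner_sum c c Finset.univ
  rw [inner_self_eq_norm_sq_to_K] at h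
  simp only [Complex.conj_mul'] at h
  apply Complex.ofReal_injective
  push_cast
  exact h

/-- A scalar matrix acts on columns of vectors with the same norm. -/
theorem sum_norm_sq_smul_le {m n : Type} [Fintype m] [Fintype n] (A : Matrix m n ℂ)
    (y : n → K) :
    ∑ i, ‖∑ j, A i j • y j‖ ^ 2 ≤ scalarOpNorm A ^ 2 * ∑ j, ‖y j‖ ^ 2 := by
  -- In orthonormal coordinates of the span of `y` the claim splits into one scalar inequality per
  -- coordinate.
  obtain ⟨d, b, hb, -, hz⟩ := exists_orthonormal_span y
  have hy : ∀ j, y j = ∑ k, inner ℂ (b k) (y j) • b k := fun j =>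
    hz _ (Submodule.subset_span ⟨j, rfl⟩)
  have h1 : ∀ i, ‖∑ j, A i j • y j‖ ^ 2 = ∑ k, ‖∑ j, A i j * inner ℂ (b k) (y j)‖ ^ 2 := by
    intro i
    rw [← norm_sq_sum_smul_of_orthonormal hb]
    congr 2
    simp only [Finset.sum_smul, mul_smul]
    rw [Finset.sum_comm]
    refine Finset.sum_congr rfl fun j _ => ?_
    rw [← Finset.smul_sum, ← hy]
  have h2 : ∀ j, ‖y j‖ ^ 2 = ∑ k, ‖inner ℂ (b k) (y j)‖ ^ 2 := by
    intro j
    rw [← norm_sq_sum_smul_of_orthonormal hb, ← hy]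
  simp only [h1, h2]
  rw [Finset.sum_comm, Finset.sum_comm (s := (Finset.univ : Finset n)), Finset.mul_sum]
  exact Finset.sum_le_sum fun k _ => scalarOpNorm_bound A _

theorem columnHilbert_smul_le {m n : Type} [Fintype m] [Fintype n] (c : ℂ) (x : Matrix m n K) :
    (columnHilbert K).nrm (c • x) ≤ ‖c‖ * (columnHilbert K).nrm x := by
  refine columnHilbert_le (mul_nonneg (norm_nonneg c) (columnHilbert_nonneg x)) fun v => ?_
  simp only [Matrix.smul_apply, smul_comm _ c, ← Finset.smul_sum, norm_smul, mul_pow,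
    ← Finset.mul_sum, mul_assoc]
  gcongr
  exact columnHilbert_bound x v

theorem columnHilbert_isOperatorSpace : (columnHilbert K).IsOperatorSpace where
  add_le x y := by
    refine le_of_eq_of_le (congrArg norm ?_) (ContinuousLinearMap.opNorm_add_le
      (operatorMatrix (x.map fun ξ : K => ContinuousLinearMap.toSpanSingleton ℂ ξ))
      (operatorMatrix (y.map fun ξ : K => ContinuousLinearMap.toSpanSingleton ℂ ξ)))
    ext v i
    simp [operatorMatrix, Finset.sum_add_distrib]
  smul_eq c x := by
    refine le_antisymm (columnHilbert_smul_le c x) ?_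
    rcases eq_or_ne c 0 with rfl | hc
    · simpa using columnHilbert_nonneg _
    · have h := columnHilbert_smul_le c⁻¹ (c • x)
      rw [inv_smul_smul₀ hc, norm_inv] at h
      calc ‖c‖ * (columnHilbert K).nrm x
          ≤ ‖c‖ * (‖c‖⁻¹ * (columnHilbert K).nrm (c • x)) := by gcongr
        _ = _ := by rw [mul_inv_cancel_left₀ (norm_ne_zero_iff.2 hc)]
  eq_zero {m n} _ _ x h := by
    classical
    ext i j
    have h1 := columnHilbert_bound x (Pi.single j 1)
    rw [h] at h1
    simp only [Pi.single_apply, ite_smul, one_smul, zero_smul, Finset.sum_ite_eq',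
      Finset.mem_univ, if_true, ne_eq, OfNat.ofNat_ne_zero, not_false_eq_true, zero_pow,
      zero_mul] at h1
    have h2 := (Finset.sum_eq_zero_iff_of_nonneg fun _ _ => by positivity).1
      (le_antisymm h1 (by positivity)) i (Finset.mem_univ i)
    simpa using h2
  directSum {m n p q} _ _ _ _ x y := by
    refine le_antisymm (columnHilbert_le (le_max_of_le_left (columnHilbert_nonneg x)) ?_)
      (max_le ?_ ?_)
    · intro v
      have hx := columnHilbert_bound x fun j => v (Sum.inl j)
      have hy := columnHilbert_bound y fun j => v (Sum.inr j)
      have h1 : (columnHilbert K).nrm x ^ 2 ≤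
          max ((columnHilbert K).nrm x) ((columnHilbert K).nrm y) ^ 2 :=
        pow_le_pow_left₀ (columnHilbert_nonneg x) (le_max_left _ _) 2
      have h2 : (columnHilbert K).nrm y ^ 2 ≤
          max ((columnHilbert K).nrm x) ((columnHilbert K).nrm y) ^ 2 :=
        pow_le_pow_left₀ (columnHilbert_nonneg y) (le_max_right _ _) 2
      simp only [Fintype.sum_sum_type, Matrix.fromBlocks_apply₁₁, Matrix.fromBlocks_apply₁₂,
        Matrix.fromBlocks_apply₂₁, Matrix.fromBlocks_apply₂₂, Matrix.zero_apply, smul_zero,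
        Finset.sum_const_zero, add_zero, zero_add, mul_add]
      refine add_le_add (hx.trans ?_) (hy.trans ?_) <;> gcongr
    · refine columnHilbert_le (columnHilbert_nonneg _) fun v => ?_
      have := columnHilbert_bound (Matrix.fromBlocks x 0 0 y) (Sum.elim v 0)
      simpa using this
    · refine columnHilbert_le (columnHilbert_nonneg _) fun v => ?_
      have := columnHilbert_bound (Matrix.fromBlocks x 0 0 y) (Sum.elim 0 v)
      simpa using this
  bimul_le {p m n q} _ _ _ _ α x β := by
    have h0 := scalarOpNorm_nonneg α
    have h1 := scalarOpNorm_nonneg β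
    have h2 := columnHilbert_nonneg x
    refine columnHilbert_le (by positivity) fun v => ?_
    -- Evaluating `α x β` on `v` means applying `β`, then `x`, then `α`; each stage has its own
    -- bound.
    have e : ∀ i, ∑ j, v j • Matrix.bimul α x β i j =
        ∑ k, α i k • ∑ l, (∑ j, β l j * v j) • x k l := by
      intro i
      simp only [Matrix.bimul, Matrix.of_apply, Finset.smul_sum, Finset.sum_smul, smul_smul]
      rw [Finset.sum_comm]
      refine Finset.sum_congr rfl fun k _ => ?_
      rw [Finset.sum_comm]
      refine Finset.sum_congr rfl fun l _ => Finset.sum_congr rfl fun j _ => ?_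
      congr 1; ring
    simp only [e]
    calc _ ≤ scalarOpNorm α ^ 2 * ∑ k, ‖∑ l, (∑ j, β l j * v j) • x k l‖ ^ 2 :=
          sum_norm_sq_smul_le α _
      _ ≤ scalarOpNorm α ^ 2 * ((columnHilbert K).nrm x ^ 2 * ∑ l, ‖∑ j, β l j * v j‖ ^ 2) := by
          gcongr; exact columnHilbert_bound x _
      _ ≤ scalarOpNorm α ^ 2 * ((columnHilbert K).nrm x ^ 2 *
            (scalarOpNorm β ^ 2 * ∑ j, ‖v j‖ ^ 2)) := by
          gcongr; exact scalarOpNorm_bound β v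
      _ = _ := by ring

theorem columnHilbert_one (ξ : K) : (columnHilbert K).one ξ = ‖ξ‖ := by
  refine le_antisymm (columnHilbert_le (norm_nonneg _) fun v => ?_) ?_
  · simp [norm_smul, mul_pow, mul_comm]
  · have := columnHilbert_bound (Matrix.of fun (_ _ : Unit) => ξ) fun _ => 1
    simp only [Finset.univ_unique, Matrix.of_apply, one_smul, Finset.sum_singleton, norm_one,
      one_pow, mul_one] at this
    exact le_of_sq_le_sq this (columnHilbert_nonneg _)

end Column

/-! ### Regular matrix norms -/

/-- The block diagonal matrix with copies of `x`, indexed by `ι`. -/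
def ampMatrix {X : Type*} [Zero X] (ι : Type) [DecidableEq ι] {m n : Type} (x : Matrix m n X) :
    Matrix (ι × m) (ι × n) X :=
  Matrix.of fun i j => if i.1 = j.1 then x i.2 j.2 else 0

/-- The part of the axioms of an operator space that does not involve sums of matrices. -/
structure Regular {X : Type*} [AddCommGroup X] [Module ℂ X] (o : MatrixNorms X) : Prop where
  nonneg : ∀ {m n : Type} [Fintype m] [Fintype n] (x : Matrix m n X), 0 ≤ o.nrm x
  bimul_le : ∀ {p m n q : Type} [Fintype p] [Fintype m] [Fintype n] [Fintype q]
    (α : Matrix p m ℂ) (x : Matrix m n X) (β : Matrix n q ℂ),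
    o.nrm (Matrix.bimul α x β) ≤ scalarOpNorm α * o.nrm x * scalarOpNorm β
  amp_le : ∀ {m n : Type} [Fintype m] [Fintype n] (k : ℕ) (x : Matrix m n X),
    o.nrm (ampMatrix (Fin k) x) ≤ o.nrm x

section General

variable {X : Type*} [AddCommGroup X] [Module ℂ X] {o : MatrixNorms X}

theorem bimul_selMatrix {p q m n : Type} [Fintype m] [Fintype n] [DecidableEq m] [DecidableEq n]
    (x : Matrix m n X) (f : p → m) (g : q → n) :
    Matrix.bimul (selMatrix f) x (selMatrix g).transpose = x.submatrix f g := by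
  ext i j
  simp [Matrix.bimul, selMatrix]

section BimulLe

variable (hb : ∀ {p m n q : Type} [Fintype p] [Fintype m] [Fintype n] [Fintype q]
    (α : Matrix p m ℂ) (x : Matrix m n X) (β : Matrix n q ℂ),
    o.nrm (Matrix.bimul α x β) ≤ scalarOpNorm α * o.nrm x * scalarOpNorm β)
  (hn : ∀ {m n : Type} [Fintype m] [Fintype n] (x : Matrix m n X), 0 ≤ o.nrm x)
include hb hn

theorem nrm_bimul_le_of_le_one {p m n q : Type} [Fintype p] [Fintype m] [Fintype n] [Fintype q]
    {α : Matrix p m ℂ} (x : Matrix m n X) {β : Matrix n q ℂ} (hα : scalarOpNorm α ≤ 1)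
    (hβ : scalarOpNorm β ≤ 1) : o.nrm (Matrix.bimul α x β) ≤ o.nrm x := by
  refine (hb α x β).trans ?_
  have := hn x
  have h1 := scalarOpNorm_nonneg α
  have h2 := scalarOpNorm_nonneg β
  calc _ ≤ 1 * o.nrm x * 1 := by gcongr
    _ = _ := by ring

theorem nrm_submatrix_le_of_bimul_le {p q m n : Type} [Fintype p] [Fintype q] [Fintype m]
    [Fintype n] (x : Matrix m n X) {f : p → m} {g : q → n} (hf : Function.Injective f)
    (hg : Function.Injective g) : o.nrm (x.submatrix f g) ≤ o.nrm x := by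
  classical
  rw [← bimul_selMatrix]
  exact nrm_bimul_le_of_le_one hb hn x (scalarOpNorm_selMatrix_le hf)
    (scalarOpNorm_selMatrix_transpose_le hg)

end BimulLe

theorem IsOperatorSpace.nrm_zero (h : o.IsOperatorSpace) {m n : Type} [Fintype m] [Fintype n] :
    o.nrm (0 : Matrix m n X) = 0 := by
  simpa using h.smul_eq 0 (0 : Matrix m n X)

/-- Nonnegativity is not an axiom; it comes from `0 = ‖x + (-x)‖ ≤ 2 ‖x‖`. -/
theorem IsOperatorSpace.nonneg (h : o.IsOperatorSpace) {m n : Type} [Fintype m] [Fintype n]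
    (x : Matrix m n X) : 0 ≤ o.nrm x := by
  have h1 := h.add_le x ((-1 : ℂ) • x)
  rw [h.smul_eq, neg_smul, one_smul, add_neg_cancel, h.nrm_zero] at h1
  simp at h1
  linarith

theorem IsOperatorSpace.regular (h : o.IsOperatorSpace) : o.Regular where
  nonneg := h.nonneg
  bimul_le := h.bimul_le
  amp_le {m n} _ _ k x := by
    induction k with
    | zero =>
      rw [Subsingleton.elim (ampMatrix (Fin 0) x) 0, h.nrm_zero]
      exact h.nonneg x
    | succ k ih =>
      -- The block with index `0` is split off, so that `directSum` applies to it and the remaining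
      -- `k` blocks.
      let f (l : Type) : Fin (k + 1) × l → l ⊕ Fin k × l := fun a =>
        Fin.cases (motive := fun _ => l ⊕ Fin k × l) (Sum.inl a.2) (fun b => Sum.inr (b, a.2)) a.1
      have hf : ∀ l, Function.Injective (f l) := by
        rintro l ⟨a, b⟩ ⟨a', b'⟩ hab
        induction a using Fin.cases <;> induction a' using Fin.cases <;> simp_all [f]
      have e : ampMatrix (Fin (k + 1)) x =
          (Matrix.fromBlocks x 0 0 (ampMatrix (Fin k) x)).submatrix (f m) (f n) := by
        ext ⟨a, b⟩ ⟨a', b'⟩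
        induction a using Fin.cases <;> induction a' using Fin.cases <;>
          simp [f, ampMatrix, Fin.succ_ne_zero, (Fin.succ_ne_zero _).symm]
      rw [e]
      refine (nrm_submatrix_le_of_bimul_le h.bimul_le h.nonneg _ (hf m) (hf n)).trans ?_
      rw [h.directSum]
      exact max_le le_rfl ih

theorem Regular.nrm_submatrix_le (h : o.Regular) {p q m n : Type} [Fintype p] [Fintype q]
    [Fintype m] [Fintype n] (x : Matrix m n X) {f : p → m} {g : q → n}
    (hf : Function.Injective f) (hg : Function.Injective g) :
    o.nrm (x.submatrix f g) ≤ o.nrm x :=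
  nrm_submatrix_le_of_bimul_le h.bimul_le h.nonneg x hf hg

theorem Regular.nrm_bimul_le (h : o.Regular) {p m n q : Type} [Fintype p] [Fintype m] [Fintype n]
    [Fintype q] {α : Matrix p m ℂ} (x : Matrix m n X) {β : Matrix n q ℂ}
    (hα : scalarOpNorm α ≤ 1) (hβ : scalarOpNorm β ≤ 1) :
    o.nrm (Matrix.bimul α x β) ≤ o.nrm x :=
  nrm_bimul_le_of_le_one h.bimul_le h.nonneg x hα hβ

theorem Regular.nrm_ampMatrix_le (h : o.Regular) (ι : Type) [Fintype ι] [DecidableEq ι]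
    {m n : Type} [Fintype m] [Fintype n] (x : Matrix m n X) :
    o.nrm (ampMatrix ι x) ≤ o.nrm x := by
  have e : ampMatrix ι x = (ampMatrix (Fin (Fintype.card ι)) x).submatrix
      (Prod.map (Fintype.equivFin ι) id) (Prod.map (Fintype.equivFin ι) id) := by
    ext ⟨a, b⟩ ⟨a', b'⟩
    simp [ampMatrix]
  rw [e]
  exact (h.nrm_submatrix_le _ ((Fintype.equivFin ι).injective.prodMap Function.injective_id)
    ((Fintype.equivFin ι).injective.prodMap Function.injective_id)).trans (h.amp_le _ _)

theorem scalars_regular : scalars.Regular :=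
  scalars_eq_columnHilbert ▸ columnHilbert_isOperatorSpace.regular

theorem scalarOpNorm_submatrix_le {p q m n : Type} [Fintype p] [Fintype q]
    [Fintype m] [Fintype n] (x : Matrix m n ℂ) {f : p → m} {g : q → n}
    (hf : Function.Injective f) (hg : Function.Injective g) :
    scalarOpNorm (x.submatrix f g) ≤ scalarOpNorm x :=
  scalars_regular.nrm_submatrix_le x hf hg

theorem scalarOpNorm_ampMatrix_le (ι : Type) [Fintype ι] [DecidableEq ι]
    {m n : Type} [Fintype m] [Fintype n] (x : Matrix m n ℂ) :
    scalarOpNorm (ampMatrix ι x) ≤ scalarOpNorm x :=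
  scalars_regular.nrm_ampMatrix_le ι x

/-- The Kronecker product factors as `A ⊗ x = (A ⊗ 1)(1 ⊗ x)`, a scalar matrix times a block
diagonal one. -/
theorem Regular.nrm_kron_le (h : o.Regular) {p q r s : Type} [Fintype p] [Fintype q] [Fintype r]
    [Fintype s] (A : Matrix p q ℂ) (x : Matrix r s X) :
    o.nrm (Matrix.of fun (i : p × r) (j : q × s) => A i.1 j.1 • x i.2 j.2) ≤
      scalarOpNorm A * o.nrm x := by
  classical
  have e : (Matrix.of fun (i : p × r) (j : q × s) => A i.1 j.1 • x i.2 j.2) =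
      Matrix.bimul ((ampMatrix r A).submatrix Prod.swap Prod.swap) (ampMatrix q x) 1 := by
    ext i j
    obtain ⟨j₁, j₂⟩ := j
    simp [Matrix.bimul, ampMatrix, Matrix.one_apply, Fintype.sum_prod_type, ite_and]
  rw [e]
  refine (h.bimul_le _ _ _).trans ?_
  have h1 := (scalarOpNorm_submatrix_le (ampMatrix r A) Prod.swap_injective
    Prod.swap_injective).trans (scalarOpNorm_ampMatrix_le r A)
  have h2 := h.nrm_ampMatrix_le q x
  have h3 := h.nonneg (ampMatrix q x)
  have h4 := scalarOpNorm_nonneg A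
  have h5 := h.nonneg x
  calc _ ≤ scalarOpNorm A * o.nrm x * 1 := by
        exact mul_le_mul (by gcongr) scalarOpNorm_one_le (scalarOpNorm_nonneg _) (by positivity)
    _ = _ := mul_one _

/-! ### Norms in `C₂[X]` -/

/-- The lift to `ℂ² ⊗ X` of a pair of linear maps on `X`. -/
def tensorLift {Z : Type*} [AddCommGroup Z] [Module ℂ Z] (T : Fin 2 → X →ₗ[ℂ] Z) :
    (Fin 2 → ℂ) ⊗[ℂ] X →ₗ[ℂ] Z :=
  TensorProduct.lift (∑ k, (LinearMap.proj k : (Fin 2 → ℂ) →ₗ[ℂ] ℂ).smulRight (T k))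

theorem tensorLift_tmul {Z : Type*} [AddCommGroup Z] [Module ℂ Z] (T : Fin 2 → X →ₗ[ℂ] Z)
    (c : Fin 2 → ℂ) (x : X) : tensorLift T (c ⊗ₜ x) = ∑ k, c k • T k x := by
  simp [tensorLift]

theorem tensorLift_toTensor {Z : Type*} [AddCommGroup Z] [Module ℂ Z] (T : Fin 2 → X →ₗ[ℂ] Z)
    (w : Fin 2 → X) : tensorLift T (toTensor w) = ∑ k, T k (w k) := by
  simp [toTensor, tensorLift_tmul, Pi.single_apply, Fin.sum_univ_two]

theorem map_bimul {X Z : Type*} [AddCommGroup X] [Module ℂ X] [AddCommGroup Z] [Module ℂ Z]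
    (L : X →ₗ[ℂ] Z) {p m n q : Type}
    [Fintype m] [Fintype n] (α : Matrix p m ℂ) (x : Matrix m n X) (β : Matrix n q ℂ) :
    (Matrix.bimul α x β).map L = Matrix.bimul α (x.map L) β := by
  ext i j
  simp [Matrix.bimul]

/-- The row `[e₀, e₁]` over `C₂`. -/
def unitRow : Matrix (Fin 1) (Fin 2) (Fin 2 → ℂ) := Matrix.of fun _ k => Pi.single k 1

theorem nrm_unitRow_le : (col scalars).nrm unitRow ≤ 1 := by
  refine scalarOpNorm_le zero_le_one fun v => ?_
  simp [unitRow, Fintype.sum_prod_type, Pi.single_apply]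

/-- The generic way to bound a norm in `C₂[X]` from above: tensor `y` with the contractive row `[e₀,
e₁]` and let `β` carry all the coefficients. Arbitrary index types are transported to `Fin`, as the
definition of `proj` requires. -/
theorem Regular.exists_factorization (h : o.Regular) {m n s : Type} [Fintype m] [Fintype n]
    [Fintype s] {v : Matrix m n (Fin 2 → X)} (y : Matrix m s X) (β : Matrix (Fin 2 × s) n ℂ)
    (hv : ∀ i j k, v i j k = ∑ l, β (k, l) j • y i l) :
    ∃ t ≤ o.nrm y * scalarOpNorm β, ∃ (p q r s : ℕ) (α : Matrix m (Fin p × Fin r) ℂ)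
    (x : Matrix (Fin p) (Fin q) (Fin 2 → ℂ)) (y : Matrix (Fin r) (Fin s) X)
    (β : Matrix (Fin q × Fin s) n ℂ),
    v.map toTensor = Matrix.bimul α (Matrix.tensorMat x y) β ∧
      t = scalarOpNorm α * (col scalars).nrm x * o.nrm y * scalarOpNorm β := by
  classical
  let em := Fintype.equivFin m
  let es := Fintype.equivFin s
  let f : m → Fin 1 × Fin (Fintype.card m) := fun i => (0, em i)
  have hf : Function.Injective f := fun a b hab => em.injective (Prod.ext_iff.1 hab).2
  let y' := y.submatrix em.symm es.symm
  let β' := β.submatrix (Prod.map id es.symm : Fin 2 × Fin (Fintype.card s) → Fin 2 × s) id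
  have h1 : o.nrm y' ≤ o.nrm y := h.nrm_submatrix_le _ em.symm.injective es.symm.injective
  have h2 : scalarOpNorm β' ≤ scalarOpNorm β := scalarOpNorm_submatrix_le _
    (Function.injective_id.prodMap es.symm.injective) Function.injective_id
  refine ⟨_, ?_, 1, 2, _, _, selMatrix f, unitRow, y', β', ?_, rfl⟩
  · have h3 := h.nonneg y'
    have h4 := scalarOpNorm_nonneg β'
    have h5 := h.nonneg y
    have h6 : 0 ≤ (col scalars).nrm unitRow := scalarOpNorm_nonneg _
    calc _ ≤ 1 * 1 * o.nrm y * scalarOpNorm β := by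
          gcongr
          · exact scalarOpNorm_selMatrix_le hf
          · exact nrm_unitRow_le
      _ = _ := by ring
  · ext i j
    have e : ∀ k, ∑ l, β' (k, l) j • y' (em i) l = v i j k := by
      intro k
      rw [hv]
      simp only [β', y', Matrix.submatrix_apply, Prod.map_apply, id_eq, Equiv.symm_apply_apply]
      exact Equiv.sum_comp es.symm fun l => β (k, l) j • y i l
    simp only [Matrix.map_apply, toTensor, Matrix.bimul, selMatrix, Matrix.of_apply, f,
      Matrix.tensorMat, ite_mul, one_mul, zero_mul, ite_smul, zero_smul,
      Finset.sum_ite_irrel, Finset.sum_const_zero, Finset.sum_ite_eq, Finset.mem_univ, if_true,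
      Fintype.sum_prod_type (α₁ := Fin 2), unitRow, ← TensorProduct.tmul_smul,
      ← TensorProduct.tmul_sum, e]

/-- Needed for lower bounds: the real infimum of an empty set would be the default value `0`. Here
`y` lists all coordinates of `v` in one long row, and `β` selects them. -/
theorem Regular.colProj_set_nonempty (h : o.Regular) {m n : Type} [Fintype m] [Fintype n]
    (v : Matrix m n (Fin 2 → X)) : ∃ t : ℝ, ∃ (p q r s : ℕ) (α : Matrix m (Fin p × Fin r) ℂ)
    (x : Matrix (Fin p) (Fin q) (Fin 2 → ℂ)) (y : Matrix (Fin r) (Fin s) X)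
    (β : Matrix (Fin q × Fin s) n ℂ),
    v.map toTensor = Matrix.bimul α (Matrix.tensorMat x y) β ∧
      t = scalarOpNorm α * (col scalars).nrm x * o.nrm y * scalarOpNorm β := by
  classical
  obtain ⟨t, -, ht⟩ := h.exists_factorization (v := v)
    (Matrix.of fun i (j : n × Fin 2) => v i j.1 j.2)
    (Matrix.of fun l j => if l.2.1 = j ∧ l.2.2 = l.1 then 1 else 0) (fun i j k => by
      simp [Fintype.sum_prod_type, ite_and])
  exact ⟨t, ht⟩

theorem Regular.colProj_le (h : o.Regular) {m n s : Type} [Fintype m] [Fintype n]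
    [Fintype s] {v : Matrix m n (Fin 2 → X)} (y : Matrix m s X) (β : Matrix (Fin 2 × s) n ℂ)
    (hv : ∀ i j k, v i j k = ∑ l, β (k, l) j • y i l) :
    o.colProj.nrm v ≤ o.nrm y * scalarOpNorm β := by
  obtain ⟨t, ht, hmem⟩ := h.exists_factorization y β hv
  refine le_trans (b := t) ?_ ht
  refine csInf_le (s := {t | _}) ⟨0, ?_⟩ hmem
  rintro _ ⟨p, q, r, s, α, x, y, β, -, rfl⟩
  have h1 := scalarOpNorm_nonneg α
  have h2 := scalarOpNorm_nonneg β
  have h3 := h.nonneg y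
  have h4 : 0 ≤ (col scalars).nrm x := scalarOpNorm_nonneg _
  positivity

/-- The universal property of the projective norm: a bound on matrices of elementary tensors
suffices, since the outer factors `α`, `β` pass through a linear map. -/
theorem Regular.nrm_le_colProj {Z : Type*} [AddCommGroup Z] [Module ℂ Z] {oZ : MatrixNorms Z}
    (h : o.Regular) (hZ : oZ.Regular) (T : Fin 2 → X →ₗ[ℂ] Z) {C : ℝ} (hC : 0 < C)
    (hT : ∀ {p q r s : ℕ} (a : Matrix (Fin p) (Fin q) (Fin 2 → ℂ)) (x : Matrix (Fin r) (Fin s) X),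
      oZ.nrm (Matrix.of fun (i : Fin p × Fin r) (j : Fin q × Fin s) =>
        ∑ k, a i.1 j.1 k • T k (x i.2 j.2)) ≤ C * ((col scalars).nrm a * o.nrm x))
    {m n : Type} [Fintype m] [Fintype n] (v : Matrix m n (Fin 2 → X)) :
    oZ.nrm (Matrix.of fun i j => ∑ k, T k (v i j k)) ≤ C * o.colProj.nrm v := by
  rw [← div_le_iff₀' hC]
  refine le_csInf (h.colProj_set_nonempty v) ?_
  rintro _ ⟨p, q, r, s, α, x, y, β, hu, rfl⟩
  rw [div_le_iff₀' hC]
  have e : (Matrix.of fun i j => ∑ k, T k (v i j k)) = Matrix.bimul α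
      (Matrix.of fun (i : Fin p × Fin r) (j : Fin q × Fin s) =>
        ∑ k, x i.1 j.1 k • T k (y i.2 j.2)) β := by
    have := congrArg (fun u => Matrix.map u (tensorLift T)) hu
    simp only [map_bimul] at this
    refine Eq.trans ?_ (this.trans ?_)
    · ext i j
      simp [tensorLift_toTensor]
    · rfl
  rw [e]
  refine (hZ.bimul_le _ _ _).trans ?_
  have h1 := scalarOpNorm_nonneg α
  have h2 := scalarOpNorm_nonneg β
  calc _ ≤ scalarOpNorm α * (C * ((col scalars).nrm x * o.nrm y)) * scalarOpNorm β := by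
        gcongr
        exact hT x y
    _ = _ := by ring

/-- A pair of maps into a Hilbert space that is bounded as a row acts boundedly on `C₂[X]`. -/
theorem Regular.columnHilbert_le_colProj {K : Type*} [NormedAddCommGroup K]
    [InnerProductSpace ℂ K] (h : o.Regular) (T : Fin 2 → X →ₗ[ℂ] K) {C : ℝ} (hC : 0 < C)
    (hT : ∀ {r s : ℕ} (x : Matrix (Fin r) (Fin s) X) (ζ : Fin 2 → Fin s → ℂ),
      ∑ i, ‖∑ k, ∑ j, ζ k j • T k (x i j)‖ ^ 2 ≤ (C * o.nrm x) ^ 2 * ∑ k, ∑ j, ‖ζ k j‖ ^ 2)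
    {m n : Type} [Fintype m] [Fintype n] (v : Matrix m n (Fin 2 → X)) :
    (columnHilbert K).nrm (Matrix.of fun i j => ∑ k, T k (v i j k)) ≤ C * o.colProj.nrm v := by
  refine h.nrm_le_colProj columnHilbert_isOperatorSpace.regular T hC (fun {p q r s} a x => ?_) v
  have h0 : 0 ≤ (col scalars).nrm a := scalarOpNorm_nonneg _
  have h1 := h.nonneg x
  refine columnHilbert_le (by positivity) fun v => ?_
  have e : ∀ i : Fin p × Fin r, ∑ j : Fin q × Fin s, v j • ∑ k, a i.1 j.1 k • T k (x i.2 j.2) =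
      ∑ k, ∑ j, (∑ l, a i.1 l k * v (l, j)) • T k (x i.2 j) := by
    intro i
    simp only [Finset.smul_sum, Finset.sum_smul, smul_smul, Fintype.sum_prod_type]
    simp only [Finset.sum_comm (s := (Finset.univ : Finset (Fin 2)))]
    rw [Finset.sum_comm]
    refine Finset.sum_congr rfl fun j _ => Finset.sum_congr rfl fun l _ =>
      Finset.sum_congr rfl fun k _ => ?_
    rw [mul_comm]
  simp only [Matrix.of_apply, e]
  rw [Fintype.sum_prod_type]
  -- For each row of `a` the row bound `hT` is applied to the coefficients produced by that row.
  -- What remains is, for each `j`, the matrix `a` read as a tall scalar matrix, whose norm is its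
  -- `C₂` norm.
  calc _ ≤ ∑ i : Fin p, (C * o.nrm x) ^ 2 * ∑ k, ∑ j, ‖∑ l, a i l k * v (l, j)‖ ^ 2 :=
        Finset.sum_le_sum fun i _ => hT x fun k j => ∑ l, a i l k * v (l, j)
    _ = (C * o.nrm x) ^ 2 * ∑ j, ∑ i : Fin p × Fin 2, ‖∑ l, a i.1 l i.2 * v (l, j)‖ ^ 2 := by
        rw [← Finset.mul_sum]
        congr 1
        simp only [Fintype.sum_prod_type]
        rw [Finset.sum_comm (s := (Finset.univ : Finset (Fin s)))]
        exact Finset.sum_congr rfl fun i _ => Finset.sum_comm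
    _ ≤ (C * o.nrm x) ^ 2 * ∑ j, ((col scalars).nrm a ^ 2 * ∑ l, ‖v (l, j)‖ ^ 2) := by
        gcongr with j
        exact scalarOpNorm_bound (Matrix.of fun (i : Fin p × Fin 2) l => a i.1 l i.2)
          fun l => v (l, j)
    _ = _ := by
        rw [← Finset.mul_sum, Fintype.sum_prod_type, Finset.sum_comm]
        ring

end General

section General

variable {X : Type*} [AddCommGroup X] [Module ℂ X] {o : MatrixNorms X}

/-! ### Transposition -/

/-- The opposite matrix norms. -/
def op {X : Type*} (o : MatrixNorms X) : MatrixNorms X where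
  nrm x := o.nrm x.transpose

theorem bimul_transpose {p m n q : Type} [Fintype m] [Fintype n] (α : Matrix p m ℂ)
    (x : Matrix m n X) (β : Matrix n q ℂ) :
    (Matrix.bimul α x β).transpose = Matrix.bimul β.transpose x.transpose α.transpose := by
  ext i j
  simp only [Matrix.bimul, Matrix.transpose_apply, Matrix.of_apply]
  rw [Finset.sum_comm]
  simp only [mul_comm]

theorem Regular.op (h : o.Regular) : o.op.Regular where
  nonneg x := h.nonneg _
  bimul_le α x β := by
    change o.nrm (Matrix.bimul α x β).transpose ≤ _
    rw [bimul_transpose]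
    refine (h.bimul_le _ _ _).trans_eq ?_
    rw [scalarOpNorm_transpose, scalarOpNorm_transpose, mul_comm, mul_comm (scalarOpNorm β),
      ← mul_assoc]
    rfl
  amp_le k x := by
    refine le_of_eq_of_le (congrArg o.nrm ?_) (h.amp_le k x.transpose)
    ext i j
    simp [ampMatrix, eq_comm]

theorem IsOperatorSpace.op (h : o.IsOperatorSpace) : o.op.IsOperatorSpace where
  add_le x y := h.add_le x.transpose y.transpose
  smul_eq c x := h.smul_eq c x.transpose
  eq_zero x hx := Matrix.transpose_injective (h.eq_zero _ hx)
  directSum x y := by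
    change o.nrm (Matrix.fromBlocks x 0 0 y).transpose = _
    rw [Matrix.fromBlocks_transpose, Matrix.transpose_zero, Matrix.transpose_zero]
    exact h.directSum _ _
  bimul_le := h.regular.op.bimul_le

/-- Transposing a factorization `α (x ⊗ y) β` gives `βᵀ (xᵀ ⊗ yᵀ) αᵀ`, of the same cost. Applied
twice, the inclusion becomes an equality. -/
theorem proj_set_transpose_subset {Y : Type*} [AddCommGroup Y] [Module ℂ Y]
    {oX oX' : MatrixNorms X} {oY oY' : MatrixNorms Y}
    (hX : ∀ {p q : ℕ} (x : Matrix (Fin p) (Fin q) X), oX'.nrm x.transpose = oX.nrm x)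
    (hY : ∀ {p q : ℕ} (x : Matrix (Fin p) (Fin q) Y), oY'.nrm x.transpose = oY.nrm x)
    {m n : Type} [Fintype m] [Fintype n] (u : Matrix m n (X ⊗[ℂ] Y)) :
    {t : ℝ | ∃ (p q r s : ℕ) (α : Matrix m (Fin p × Fin r) ℂ)
      (x : Matrix (Fin p) (Fin q) X) (y : Matrix (Fin r) (Fin s) Y)
      (β : Matrix (Fin q × Fin s) n ℂ),
      u = Matrix.bimul α (Matrix.tensorMat x y) β ∧
        t = scalarOpNorm α * oX.nrm x * oY.nrm y * scalarOpNorm β} ⊆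
    {t : ℝ | ∃ (p q r s : ℕ) (α : Matrix n (Fin p × Fin r) ℂ)
      (x : Matrix (Fin p) (Fin q) X) (y : Matrix (Fin r) (Fin s) Y)
      (β : Matrix (Fin q × Fin s) m ℂ),
      u.transpose = Matrix.bimul α (Matrix.tensorMat x y) β ∧
        t = scalarOpNorm α * oX'.nrm x * oY'.nrm y * scalarOpNorm β} := by
  rintro _ ⟨p, q, r, s, α, x, y, β, hu, rfl⟩
  refine ⟨q, p, s, r, β.transpose, x.transpose, y.transpose, α.transpose, ?_, ?_⟩
  · rw [hu, bimul_transpose]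
    rfl
  · rw [scalarOpNorm_transpose, scalarOpNorm_transpose, hX, hY]
    ring

theorem proj_transpose {Y : Type*} [AddCommGroup Y] [Module ℂ Y]
    {oX oX' : MatrixNorms X} {oY oY' : MatrixNorms Y}
    (hX : ∀ {p q : ℕ} (x : Matrix (Fin p) (Fin q) X), oX'.nrm x.transpose = oX.nrm x)
    (hY : ∀ {p q : ℕ} (x : Matrix (Fin p) (Fin q) Y), oY'.nrm x.transpose = oY.nrm x)
    {m n : Type} [Fintype m] [Fintype n] (u : Matrix m n (X ⊗[ℂ] Y)) :
    (proj oX oY).nrm u = (proj oX' oY').nrm u.transpose :=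
  congrArg sInf (Set.Subset.antisymm (proj_set_transpose_subset hX hY u)
    (proj_set_transpose_subset (fun x => (hX x.transpose).symm) (fun y => (hY y.transpose).symm)
      u.transpose))

theorem op_colProj {m n : Type} [Fintype m] [Fintype n] (v : Matrix m n (Fin 2 → X)) :
    o.op.colProj.nrm v = o.rowProj.nrm v.transpose := by
  have hX : ∀ {p q : ℕ} (x : Matrix (Fin p) (Fin q) (Fin 2 → ℂ)),
      (row scalars).nrm x.transpose = (col scalars).nrm x := fun {p q} x =>
    scalarOpNorm_transpose (Matrix.of fun (i : Fin p × Fin 2) (j : Fin q) => x i.1 j i.2)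
  have hY : ∀ {p q : ℕ} (x : Matrix (Fin p) (Fin q) X), o.nrm x.transpose = o.op.nrm x :=
    fun _ => rfl
  exact proj_transpose hX hY (v.map toTensor)

variable (o) in
theorem op_leftM : o.op.leftM = o.rightM := rfl

variable (o) in
theorem op_leftL : o.op.leftL = o.rightL := by
  ext P
  refine and_congr_right fun _ => forall_congr' fun x => ?_
  change o.one x = o.op.colProj.nrm _ ↔ o.one x = _
  rw [op_colProj]
  rfl

variable (o) in
theorem op_completeLeftM : o.op.completeLeftM = o.completeRightM := by
  ext P
  refine forall_congr' fun n => and_congr_right fun _ => ?_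
  have e : ∀ x : Matrix (Fin n) (Fin n) X, (o.op.amplify n).col.one (splitMap P.mapMatrix x) =
      (o.amplify n).row.one (splitMap P.mapMatrix x.transpose) := fun x => by
    refine congrArg o.nrm ?_
    ext ⟨i, a⟩ ⟨⟨j, k⟩, b⟩
    fin_cases k <;> rfl
  exact ⟨fun h x => (h x.transpose).trans (e x.transpose),
    fun h x => (h x.transpose).trans (e x).symm⟩

variable (o) in
theorem op_completeLeftL : o.op.completeLeftL = o.completeRightL := by
  ext P
  refine and_congr_right fun _ => forall_congr' fun n => ?_
  have e : ∀ x : Matrix (Fin n) (Fin n) X, o.op.colProj.nrm (x.map (splitMap P)) = o.op.nrm x ↔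
      o.rowProj.nrm (x.transpose.map (splitMap P)) = o.nrm x.transpose := fun x => by
    rw [op_colProj]; rfl
  exact ⟨fun h x => (e x.transpose).1 (h x.transpose), fun h x => (e x).2 (h x.transpose)⟩

/-! ### Regularity of amplifications and reindexing -/

theorem Regular.amplify (h : o.Regular) (N : ℕ) : (o.amplify N).Regular where
  nonneg x := h.nonneg _
  bimul_le {p m n q} _ _ _ _ α x β := by
    classical
    -- On the flattened matrix, `α` and `β` act as `α ⊗ 1` and `β ⊗ 1`.
    have e : Matrix.comp p q (Fin N) (Fin N) X (Matrix.bimul α x β) =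
        Matrix.bimul ((ampMatrix (Fin N) α).submatrix Prod.swap Prod.swap)
          (Matrix.comp m n (Fin N) (Fin N) X x)
          ((ampMatrix (Fin N) β).submatrix Prod.swap Prod.swap) := by
      ext ⟨i, a⟩ ⟨j, b⟩
      simp [Matrix.bimul, ampMatrix, Matrix.sum_apply, Fintype.sum_prod_type]
    change o.nrm (Matrix.comp p q (Fin N) (Fin N) X (Matrix.bimul α x β)) ≤
      scalarOpNorm α * o.nrm (Matrix.comp m n (Fin N) (Fin N) X x) * scalarOpNorm β
    rw [e]
    refine (h.bimul_le _ _ _).trans ?_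
    have h1 := h.nonneg (Matrix.comp m n (Fin N) (Fin N) X x)
    have h2 := scalarOpNorm_nonneg α
    refine mul_le_mul (mul_le_mul_of_nonneg_right ?_ h1) ?_ (scalarOpNorm_nonneg _)
      (by positivity)
    · exact (scalarOpNorm_submatrix_le _ Prod.swap_injective Prod.swap_injective).trans
        (scalarOpNorm_ampMatrix_le _ _)
    · exact (scalarOpNorm_submatrix_le _ Prod.swap_injective Prod.swap_injective).trans
        (scalarOpNorm_ampMatrix_le _ _)
  amp_le {m n} _ _ k x := by
    have e : Matrix.comp (Fin k × m) (Fin k × n) (Fin N) (Fin N) X (ampMatrix (Fin k) x) =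
        (ampMatrix (Fin k) (Matrix.comp m n (Fin N) (Fin N) X x)).submatrix
          (Equiv.prodAssoc _ _ _) (Equiv.prodAssoc _ _ _) := by
      ext ⟨⟨i, a⟩, s⟩ ⟨⟨j, b⟩, t⟩
      by_cases hij : i = j <;> simp [ampMatrix, hij]
    change o.nrm (Matrix.comp (Fin k × m) (Fin k × n) (Fin N) (Fin N) X (ampMatrix (Fin k) x)) ≤ _
    rw [e]
    exact (h.nrm_submatrix_le _ (Equiv.injective _) (Equiv.injective _)).trans (h.amp_le _ _)

theorem Regular.nrm_submatrix_equiv (h : o.Regular) {p q m n : Type} [Fintype p] [Fintype q]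
    [Fintype m] [Fintype n] (x : Matrix m n X) (f : p ≃ m) (g : q ≃ n) :
    o.nrm (x.submatrix f g) = o.nrm x := by
  refine le_antisymm (h.nrm_submatrix_le x f.injective g.injective) ?_
  simpa using h.nrm_submatrix_le (x.submatrix f g) f.symm.injective g.symm.injective

/-- Restricting the rows of `α` and the columns of `β` turns a factorization of `v` into one of the
submatrix, at no greater cost. -/
theorem Regular.colProj_submatrix_le (h : o.Regular) {p q m n : Type} [Fintype p] [Fintype q]
    [Fintype m] [Fintype n] (v : Matrix m n (Fin 2 → X)) {f : p → m} {g : q → n}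
    (hf : Function.Injective f) (hg : Function.Injective g) :
    o.colProj.nrm (v.submatrix f g) ≤ o.colProj.nrm v := by
  refine le_csInf (h.colProj_set_nonempty v) ?_
  rintro _ ⟨p, q, r, s, α, x, y, β, hu, rfl⟩
  have h3 := h.nonneg y
  have h4 : 0 ≤ (col scalars).nrm x := scalarOpNorm_nonneg _
  have h5 := scalarOpNorm_nonneg (α.submatrix f id)
  have h6 := scalarOpNorm_nonneg (β.submatrix id g)
  refine le_trans (csInf_le (a := scalarOpNorm (α.submatrix f id) * (col scalars).nrm x * o.nrm y *
    scalarOpNorm (β.submatrix id g)) ⟨0, ?_⟩ ⟨p, q, r, s, _, x, y, _, ?_, rfl⟩) ?_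
  · rintro _ ⟨p, q, r, s, α, x, y, β, -, rfl⟩
    have h1 := scalarOpNorm_nonneg α
    have h2 := scalarOpNorm_nonneg β
    have h3 := h.nonneg y
    have h4 : 0 ≤ (col scalars).nrm x := scalarOpNorm_nonneg _
    positivity
  · ext i j
    exact congrFun (congrFun hu (f i)) (g j)
  · have h7 := scalarOpNorm_submatrix_le α hf Function.injective_id
    have h8 := scalarOpNorm_submatrix_le β Function.injective_id hg
    have h9 := h5.trans h7
    gcongr

theorem Regular.colProj_submatrix_equiv (h : o.Regular) {p q m n : Type} [Fintype p] [Fintype q]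
    [Fintype m] [Fintype n] (v : Matrix m n (Fin 2 → X)) (f : p ≃ m) (g : q ≃ n) :
    o.colProj.nrm (v.submatrix f g) = o.colProj.nrm v := by
  refine le_antisymm (h.colProj_submatrix_le v f.injective g.injective) ?_
  simpa using h.colProj_submatrix_le (v.submatrix f g) f.symm.injective g.symm.injective

/-! ### Coordinates of `C₂(X)` and `C₂[X]` -/

theorem Regular.nrm_apply_le_col (h : o.Regular) {m n : Type} [Fintype m] [Fintype n]
    (v : Matrix m n (Fin 2 → X)) (k : Fin 2) :
    o.nrm (Matrix.of fun i j => v i j k) ≤ o.col.nrm v :=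
  h.nrm_submatrix_le (Matrix.of fun (i : m × Fin 2) (j : n) => v i.1 j i.2)
    (f := fun i => (i, k)) (g := id) (fun _ _ hab => (Prod.ext_iff.1 hab).1) Function.injective_id

theorem Regular.col_single (h : o.Regular) {m n : Type} [Fintype m] [Fintype n]
    (x : Matrix m n X) (k : Fin 2) :
    o.col.nrm (x.map fun ξ => (Pi.single k ξ : Fin 2 → X)) = o.nrm x := by
  classical
  refine le_antisymm ?_ ?_
  · have e : (Matrix.of fun (i : m × Fin 2) (j : n) => (Pi.single k (x i.1 j) : Fin 2 → X) i.2) =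
        Matrix.bimul (selMatrix fun i : m => (i, k)).transpose x 1 := by
      ext ⟨i, l⟩ j
      by_cases hl : k = l
      · subst hl
        simp [Matrix.bimul, selMatrix, Matrix.one_apply]
      · simp [Matrix.bimul, selMatrix, hl, Ne.symm hl]
    change o.nrm (Matrix.of fun (i : m × Fin 2) (j : n) =>
      (Pi.single k (x i.1 j) : Fin 2 → X) i.2) ≤ _
    rw [e]
    exact h.nrm_bimul_le _ (scalarOpNorm_selMatrix_transpose_le
      fun _ _ hab => (Prod.ext_iff.1 hab).1) scalarOpNorm_one_le
  · refine le_of_eq_of_le (congrArg o.nrm ?_) (h.nrm_apply_le_col _ k)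
    ext i j
    simp

/-- The coordinate map sends `a ⊗ x` to the Kronecker product of a coordinate of `a` with `x`, so
`nrm_kron_le` bounds it on elementary tensors. -/
theorem Regular.nrm_apply_le_colProj (h : o.Regular) {m n : Type} [Fintype m] [Fintype n]
    (v : Matrix m n (Fin 2 → X)) (k : Fin 2) :
    o.nrm (Matrix.of fun i j => v i j k) ≤ o.colProj.nrm v := by
  have key := h.nrm_le_colProj h (fun l => if l = k then LinearMap.id else 0) zero_lt_one
    (fun {p q r s} a x => ?_) v
  · rw [one_mul] at key
    refine le_of_eq_of_le (congrArg o.nrm ?_) key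
    ext i j
    fin_cases k <;> simp
  · have e : (Matrix.of fun (i : Fin p × Fin r) (j : Fin q × Fin s) =>
        ∑ l, a i.1 j.1 l • (if l = k then LinearMap.id else 0 : X →ₗ[ℂ] X) (x i.2 j.2)) =
        Matrix.of fun i j => (Matrix.of fun i j => a i j k) i.1 j.1 • x i.2 j.2 := by
      ext i j
      fin_cases k <;> simp
    rw [e, one_mul]
    refine (h.nrm_kron_le _ _).trans (mul_le_mul_of_nonneg_right ?_ (h.nonneg x))
    exact scalars_regular.nrm_apply_le_col a k

theorem Regular.colProj_single (h : o.Regular) {m n : Type} [Fintype m] [Fintype n]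
    (x : Matrix m n X) (k : Fin 2) :
    o.colProj.nrm (x.map fun ξ => (Pi.single k ξ : Fin 2 → X)) = o.nrm x := by
  classical
  refine le_antisymm ?_ ?_
  · refine (h.colProj_le x (selMatrix fun j : n => (k, j)).transpose fun i j l => ?_).trans ?_
    · by_cases hl : k = l
      · subst hl
        simp [selMatrix]
      · simp [selMatrix, hl, Ne.symm hl]
    · exact mul_le_of_le_one_right (h.nonneg x) (scalarOpNorm_selMatrix_transpose_le
        fun _ _ hab => (Prod.ext_iff.1 hab).2)
  · refine le_of_eq_of_le (congrArg o.nrm ?_) (h.nrm_apply_le_colProj _ k)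
    ext i j
    simp

theorem splitMap_zero : splitMap (0 : X →ₗ[ℂ] X) = fun x => (Pi.single 1 x : Fin 2 → X) := by
  ext x k
  fin_cases k <;> simp [splitMap]

theorem splitMap_id :
    splitMap (LinearMap.id : X →ₗ[ℂ] X) = fun x => (Pi.single 0 x : Fin 2 → X) := by
  ext x k
  fin_cases k <;> simp [splitMap]

/-! ### General properties of one-sided projections -/

theorem Regular.zero_mem_leftM (h : o.Regular) : (0 : X →ₗ[ℂ] X) ∈ o.leftM :=
  ⟨by simp, fun x => by
    rw [splitMap_zero]; exact (h.col_single (Matrix.of fun (_ _ : Unit) => x) 1).symm⟩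

theorem Regular.id_mem_leftM (h : o.Regular) : (LinearMap.id : X →ₗ[ℂ] X) ∈ o.leftM :=
  ⟨by simp, fun x => by
    rw [splitMap_id]; exact (h.col_single (Matrix.of fun (_ _ : Unit) => x) 0).symm⟩

theorem Regular.zero_mem_completeLeftM (h : o.Regular) :
    (0 : X →ₗ[ℂ] X) ∈ o.completeLeftM := fun n => by
  have e : (0 : X →ₗ[ℂ] X).mapMatrix = (0 : Matrix (Fin n) (Fin n) X →ₗ[ℂ] _) := by
    ext; simp
  rw [e]
  exact (h.amplify n).zero_mem_leftM

theorem Regular.id_mem_completeLeftM (h : o.Regular) :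
    (LinearMap.id : X →ₗ[ℂ] X) ∈ o.completeLeftM := fun n => by
  rw [LinearMap.mapMatrix_id]
  exact (h.amplify n).id_mem_leftM

theorem Regular.zero_mem_completeLeftL (h : o.Regular) :
    (0 : X →ₗ[ℂ] X) ∈ o.completeLeftL :=
  ⟨by simp, fun n x => by rw [splitMap_zero]; exact h.colProj_single x 1⟩

theorem Regular.id_mem_completeLeftL (h : o.Regular) :
    (LinearMap.id : X →ₗ[ℂ] X) ∈ o.completeLeftL :=
  ⟨by simp, fun n x => by rw [splitMap_id]; exact h.colProj_single x 0⟩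

/-- This is the case `n = 1` of the definition, up to reindexing singletons. -/
theorem Regular.completeLeftM_subset (h : o.Regular) : o.completeLeftM ⊆ o.leftM := by
  intro P hP
  obtain ⟨h1, h2⟩ := hP 1
  refine ⟨?_, fun x => ?_⟩
  · ext x
    exact congrFun (congrFun (LinearMap.congr_fun h1 (Matrix.of fun _ _ => x)) 0) 0
  · have h3 := h2 (Matrix.of fun _ _ => x)
    have e1 := h.nrm_submatrix_equiv (Matrix.of fun (_ _ : Unit) => x)
      (Equiv.prodUnique Unit (Fin 1)) (Equiv.prodUnique Unit (Fin 1))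
    have e2 := h.nrm_submatrix_equiv
      (Matrix.of fun (i : Unit × Fin 2) (_ : Unit) => splitMap P x i.2)
      (Equiv.prodUnique (Unit × Fin 2) (Fin 1)) (Equiv.prodUnique Unit (Fin 1))
    refine e1.symm.trans ((Eq.trans ?_ h3).trans (Eq.trans (congrArg o.nrm ?_) e2))
    · rfl
    · ext ⟨⟨i, k⟩, a⟩ ⟨j, b⟩
      fin_cases k <;> rfl

theorem Regular.completeLeftL_subset (h : o.Regular) : o.completeLeftL ⊆ o.leftL := by
  rintro P ⟨h1, h2⟩
  refine ⟨h1, fun x => ?_⟩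
  let e : Unit ≃ Fin 1 := Equiv.ofUnique _ _
  exact (h.nrm_submatrix_equiv (Matrix.of fun (_ _ : Fin 1) => x) e e).trans ((h2 1 _).symm.trans
    (h.colProj_submatrix_equiv (Matrix.of fun (_ _ : Fin 1) => splitMap P x) e e).symm)

end General

/-! ### One-sided projections on a quantized Hilbert space -/

section Hilbert

variable {H : Type*} [NormedAddCommGroup H] [InnerProductSpace ℂ H]

/-- Choose `c` so that `u + c • v` is orthogonal to `v`. By Pythagoras it is shorter than `u` unless
`c • v = 0`. -/
theorem inner_eq_zero_of_forall_norm_le {u v : H} (h : ∀ c : ℂ, ‖u‖ ≤ ‖u + c • v‖) :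
    inner ℂ v u = 0 := by
  rcases eq_or_ne v 0 with rfl | hv
  · simp
  set c : ℂ := -(inner ℂ v u / (‖v‖ : ℂ) ^ 2) with hc
  have hv0 : (‖v‖ : ℂ) ≠ 0 := by exact_mod_cast norm_ne_zero_iff.2 hv
  have horth : inner ℂ v (u + c • v) = 0 := by
    rw [inner_add_right, inner_smul_right, inner_self_eq_norm_sq_to_K]
    simp only [hc, Complex.coe_algebraMap]
    field_simp
    ring
  have h1 : ‖u‖ ^ 2 = ‖u + c • v‖ ^ 2 + ‖c • v‖ ^ 2 := by
    have := norm_sub_sq (𝕜 := ℂ) (u + c • v) (c • v)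
    rw [add_sub_cancel_right, inner_smul_right, ← inner_conj_symm, horth] at this
    simpa using this
  have h2 : ‖c • v‖ ^ 2 ≤ 0 := by nlinarith [h c, norm_nonneg u]
  have h3 : c = 0 := by
    have : c • v = 0 := by
      rw [← norm_eq_zero]; exact pow_eq_zero_iff two_ne_zero |>.1 (le_antisymm h2 (sq_nonneg _))
    exact (smul_eq_zero.1 this).resolve_right hv
  simpa [h3] using horth

theorem Regular.completeLeftM_eq_trivialProj {o : MatrixNorms H} (h : o.Regular)
    (hsub : o.completeLeftM ⊆ trivialProj H) : o.completeLeftM = trivialProj H := by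
  refine Set.Subset.antisymm hsub ?_
  rintro P (rfl | rfl)
  exacts [h.zero_mem_completeLeftM, h.id_mem_completeLeftM]

theorem Regular.completeLeftL_eq_trivialProj {o : MatrixNorms H} (h : o.Regular)
    (hsub : o.completeLeftL ⊆ trivialProj H) : o.completeLeftL = trivialProj H := by
  refine Set.Subset.antisymm hsub ?_
  rintro P (rfl | rfl)
  exacts [h.zero_mem_completeLeftL, h.id_mem_completeLeftL]

theorem splitMap_add_of_mem {P : H →ₗ[ℂ] H} {u v : H} (hu : P u = u) (hv : P v = 0) :
    splitMap P (u + v) = ![u, v] := by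
  simp [splitMap, hu, hv]

theorem norm_add_of_orthonormal {u v : H} (h : Orthonormal ℂ ![u, v]) : ‖u + v‖ = √2 := by
  have := norm_sq_sum_smul_of_orthonormal h fun _ => 1
  simp only [Fin.sum_univ_two, one_smul, Matrix.cons_val_zero, Matrix.cons_val_one, norm_one] at this
  rw [← Real.sqrt_sq (norm_nonneg (u + v)), this]
  norm_num

variable [CompleteSpace H]

/-- Continuity is automatic: a symmetric idempotent satisfies `‖P x‖² = ⟪x, P x⟫ ≤ ‖x‖ ‖P x‖`. -/
theorem mem_orthProj_iff {P : H →ₗ[ℂ] H} :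
    P ∈ orthProj H ↔ P ∘ₗ P = P ∧ ∀ x y, inner ℂ (P x) y = inner ℂ x (P y) := by
  constructor
  · rintro ⟨p, hp, rfl⟩
    refine ⟨LinearMap.ext fun x => DFunLike.congr_fun hp.1 x, fun x y => ?_⟩
    exact (ContinuousLinearMap.isSelfAdjoint_iff_isSymmetric.1 hp.2) x y
  · rintro ⟨h1, h2⟩
    have h3 : ∀ x, P (P x) = P x := fun x => LinearMap.congr_fun h1 x
    have h4 : ∀ x, ‖P x‖ ≤ 1 * ‖x‖ := fun x => by
      have h5 := norm_inner_le_norm (𝕜 := ℂ) x (P x)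
      rw [← h3 x, ← h2, inner_self_eq_norm_sq_to_K, h3] at h5
      simp only [Complex.coe_algebraMap, norm_pow, Complex.norm_real, norm_norm] at h5
      rw [one_mul]
      by_contra! hlt
      have := norm_nonneg x
      nlinarith
    refine ⟨P.mkContinuous 1 h4, ⟨?_, ?_⟩, rfl⟩
    · ext x
      exact h3 x
    · exact ContinuousLinearMap.isSelfAdjoint_iff_isSymmetric.2 h2

/-- For `u` in the range and `w` in the kernel, contractivity says `‖u‖ ≤ ‖u + c • w‖` for all `c`.
So range and kernel are orthogonal, which makes `P` symmetric. -/
theorem mem_orthProj_of_norm_le {P : H →ₗ[ℂ] H} (h1 : P ∘ₗ P = P) (h2 : ∀ x, ‖P x‖ ≤ ‖x‖) :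
    P ∈ orthProj H := by
  have h3 : ∀ x, P (P x) = P x := fun x => LinearMap.congr_fun h1 x
  have h4 : ∀ x y, inner ℂ (y - P y) (P x) = 0 := fun x y =>
    inner_eq_zero_of_forall_norm_le fun c => by
      simpa [h3] using h2 (P x + c • (y - P y))
  have h5 : ∀ x y, inner ℂ (P x) (y - P y) = 0 := fun x y => by
    rw [← inner_conj_symm, h4, map_zero]
  refine mem_orthProj_iff.2 ⟨h1, fun x y => ?_⟩
  calc inner ℂ (P x) y = inner ℂ (P x) (P y) + inner ℂ (P x) (y - P y) := by
        rw [← inner_add_right, add_sub_cancel]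
    _ = inner ℂ (P x) (P y) + inner ℂ (x - P x) (P y) := by rw [h5, h4]
    _ = _ := by rw [← inner_add_left, add_sub_cancel]

variable {o : MatrixNorms H}

theorem Regular.leftM_subset (h : o.Regular) (h1 : ∀ ξ, o.one ξ = ‖ξ‖) :
    o.leftM ⊆ orthProj H := by
  rintro P ⟨hP, hx⟩
  refine mem_orthProj_of_norm_le hP fun x => ?_
  rw [← h1, ← h1, hx x]
  exact h.nrm_apply_le_col (Matrix.of fun (_ _ : Unit) => splitMap P x) 0

theorem Regular.leftL_subset (h : o.Regular) (h1 : ∀ ξ, o.one ξ = ‖ξ‖) :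
    o.leftL ⊆ orthProj H := by
  rintro P ⟨hP, hx⟩
  refine mem_orthProj_of_norm_le hP fun x => ?_
  rw [← h1, ← h1, hx x]
  exact h.nrm_apply_le_colProj (Matrix.of fun (_ _ : Unit) => splitMap P x) 0

theorem exists_orthonormal_pair {P : H →ₗ[ℂ] H} (hP : P ∈ orthProj H) (hP' : P ∉ trivialProj H) :
    ∃ u v, P u = u ∧ P v = 0 ∧ Orthonormal ℂ ![u, v] := by
  obtain ⟨h1, h2⟩ := mem_orthProj_iff.1 hP
  have h3 : ∀ x, P (P x) = P x := fun x => LinearMap.congr_fun h1 x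
  have h4 : P ≠ 0 := fun h => hP' (Or.inl h)
  have h5 : P ≠ LinearMap.id := fun h => hP' (Or.inr h)
  obtain ⟨a, ha⟩ : ∃ a, P a ≠ 0 := by
    by_contra! hc
    exact h4 (LinearMap.ext hc)
  obtain ⟨b, hb⟩ : ∃ b, b - P b ≠ 0 := by
    by_contra! hc
    exact h5 (LinearMap.ext fun x => (sub_eq_zero.1 (hc x)).symm)
  refine ⟨(‖P a‖⁻¹ : ℂ) • P a, (‖b - P b‖⁻¹ : ℂ) • (b - P b), ?_, ?_, ?_⟩
  · rw [map_smul, h3]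
  · rw [map_smul, map_sub, h3, sub_self, smul_zero]
  · have hin : inner ℂ (P a) (b - P b) = 0 := by rw [h2, map_sub, h3, sub_self, inner_zero_right]
    have hu : (‖P a‖ : ℂ) ≠ 0 := by exact_mod_cast norm_ne_zero_iff.2 ha
    have hv : (‖b - P b‖ : ℂ) ≠ 0 := by exact_mod_cast norm_ne_zero_iff.2 hb
    simp [orthonormal_vecCons_iff, norm_smul, inner_smul_left, inner_smul_right, hin, ha, hb]

theorem subset_trivialProj {S : Set (H →ₗ[ℂ] H)} (hS : S ⊆ orthProj H)
    (h : ∀ P ∈ S, ∀ u v, P u = u → P v = 0 → ¬ Orthonormal ℂ ![u, v]) :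
    S ⊆ trivialProj H := by
  intro P hP
  by_contra hP'
  obtain ⟨u, v, hu, hv, huv⟩ := exists_orthonormal_pair (hS hP) hP'
  exact h P hP u v hu hv huv

/-- The test behind all `{0, I}` entries for `M`: a nontrivial projection would give some
orthonormal pair the same norm `√2` as `u + v`. -/
theorem Regular.leftM_eq_trivialProj (h : o.Regular) (h1 : ∀ ξ, o.one ξ = ‖ξ‖)
    (hne : ∀ u v, Orthonormal ℂ ![u, v] → o.col.one ![u, v] ≠ √2) :
    o.leftM = trivialProj H := by
  refine Set.Subset.antisymm (subset_trivialProj (h.leftM_subset h1) ?_) ?_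
  · rintro P ⟨-, hP⟩ u v hu hv huv
    apply hne u v huv
    rw [← splitMap_add_of_mem hu hv, ← hP, h1, norm_add_of_orthonormal huv]
  · rintro P (rfl | rfl)
    exacts [h.zero_mem_leftM, h.id_mem_leftM]

theorem Regular.leftL_eq_trivialProj (h : o.Regular) (h1 : ∀ ξ, o.one ξ = ‖ξ‖)
    (hne : ∀ u v, Orthonormal ℂ ![u, v] → o.colProj.one ![u, v] ≠ √2) :
    o.leftL = trivialProj H := by
  refine Set.Subset.antisymm (subset_trivialProj (h.leftL_subset h1) ?_) ?_
  · rintro P ⟨-, hP⟩ u v hu hv huv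
    apply hne u v huv
    rw [← splitMap_add_of_mem hu hv, ← hP, h1, norm_add_of_orthonormal huv]
  · rintro P (rfl | rfl)
    exacts [h.completeLeftL_subset h.zero_mem_completeLeftL,
      h.completeLeftL_subset h.id_mem_completeLeftL]

end Hilbert

/-! ### Lower bounds in `C₂[X]` from pairs of functionals -/

section General

variable {X : Type*} [AddCommGroup X] [Module ℂ X] {o : MatrixNorms X}

/-- Pairs of functionals that are bounded as rows give lower bounds for the norm of `C₂[X]`. -/
theorem Regular.norm_le_colProj_one (h : o.Regular) (f : Fin 2 → X →ₗ[ℂ] ℂ) {C : ℝ} (hC : 0 < C)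
    (hf : ∀ {r s : ℕ} (x : Matrix (Fin r) (Fin s) X),
      scalarOpNorm (Matrix.of fun (l : Fin 2 × Fin s) (i : Fin r) => f l.1 (x i l.2)) ≤
        C * o.nrm x) (w : Fin 2 → X) :
    ‖∑ k, f k (w k)‖ ≤ C * o.colProj.one w := by
  rw [← columnHilbert_one]
  refine h.columnHilbert_le_colProj f hC (fun {r s} x ζ => ?_) (Matrix.of fun (_ _ : Unit) => w)
  have h1 := hf x
  rw [← scalarOpNorm_transpose] at h1
  have h2 := scalarOpNorm_bound
    (Matrix.of fun (l : Fin 2 × Fin s) (i : Fin r) => f l.1 (x i l.2)).transpose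
    fun l => ζ l.1 l.2
  simp only [Fintype.sum_prod_type, Matrix.transpose_apply, Matrix.of_apply] at h2
  simp only [smul_eq_mul, mul_comm (ζ _ _)]
  refine h2.trans ?_
  have := scalarOpNorm_nonneg
    (Matrix.of fun (l : Fin 2 × Fin s) (i : Fin r) => f l.1 (x i l.2)).transpose
  gcongr

end General

section Hilbert

variable {H : Type*} [NormedAddCommGroup H] [InnerProductSpace ℂ H]

theorem columnHilbert_regular : (columnHilbert H).Regular :=
  columnHilbert_isOperatorSpace.regular

theorem sum_norm_sq_inner_le {ι : Type*} [Fintype ι] {b : ι → H} (hb : Orthonormal ℂ b) (z : H) :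
    ∑ k, ‖inner ℂ (b k) z‖ ^ 2 ≤ ‖z‖ ^ 2 :=
  hb.sum_inner_products_le z

/-! ### Row Hilbert space -/

/-- Pairing `T g` with its own conjugate moves the scalars onto `xᵀ`, giving `‖T g‖² ≤ ‖g‖ ‖xᵀ‖ ‖T
g‖`. -/
theorem rowHilbert_nrm_le {m n : Type} [Fintype m] [Fintype n] (x : Matrix m n H) :
    (rowHilbert H).nrm x ≤ (columnHilbert H).nrm x.transpose := by
  set N := (columnHilbert H).nrm x.transpose
  have hN : 0 ≤ N := columnHilbert_nonneg _
  refine ContinuousLinearMap.opNorm_le_bound _ hN fun g => ?_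
  set G := ‖g‖
  set T := operatorMatrix (x.map fun ξ : H => NormedSpace.inclusionInDoubleDual ℂ H ξ)
  have hT : ∀ i, T g i = ∑ j, g j (x i j) := fun i => by simp [T, operatorMatrix]
  have hG : ∑ j, ‖g j‖ ^ 2 = G ^ 2 := (PiLp.norm_sq_eq_of_L2 _ g).symm
  have hS : ‖T g‖ ^ 2 = ∑ i, ‖T g i‖ ^ 2 := PiLp.norm_sq_eq_of_L2 _ _
  have h1 : ((‖T g‖ ^ 2 : ℝ) : ℂ) = ∑ j, g j (∑ i, starRingEnd ℂ (T g i) • x i j) := by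
    rw [hS]
    push_cast
    simp only [map_sum, map_smul, smul_eq_mul]
    rw [Finset.sum_comm]
    refine Finset.sum_congr rfl fun i _ => ?_
    rw [← Finset.mul_sum, ← hT, Complex.conj_mul']
  have h2 := columnHilbert_bound x.transpose fun i => starRingEnd ℂ (T g i)
  simp only [RCLike.norm_conj, Matrix.transpose_apply, ← hS] at h2
  have h3 : ‖T g‖ ^ 2 ≤ G * (N * ‖T g‖) := by
    calc ‖T g‖ ^ 2 = ‖((‖T g‖ ^ 2 : ℝ) : ℂ)‖ := by
          rw [Complex.norm_real, Real.norm_of_nonneg (sq_nonneg _)]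
      _ ≤ ∑ j, ‖g j‖ * ‖∑ i, starRingEnd ℂ (T g i) • x i j‖ := by
          rw [h1]
          exact (norm_sum_le _ _).trans (Finset.sum_le_sum fun j _ => (g j).le_opNorm _)
      _ ≤ √(∑ j, ‖g j‖ ^ 2) * √(∑ j, ‖∑ i, starRingEnd ℂ (T g i) • x i j‖ ^ 2) :=
          Real.sum_mul_le_sqrt_mul_sqrt _ _ _
      _ ≤ √(G ^ 2) * √(N ^ 2 * ‖T g‖ ^ 2) := by
          rw [hG]; gcongr
      _ = _ := by
          rw [← mul_pow, Real.sqrt_sq (norm_nonneg g), Real.sqrt_sq (by positivity)]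
  by_contra! hlt
  have h4 : 0 < ‖T g‖ := lt_of_le_of_lt (by positivity) hlt
  nlinarith

theorem le_rowHilbert_nrm {m n : Type} [Fintype m] [Fintype n] (x : Matrix m n H) :
    (columnHilbert H).nrm x.transpose ≤ (rowHilbert H).nrm x := by
  set N := (rowHilbert H).nrm x
  have hN : 0 ≤ N := ContinuousLinearMap.opNorm_nonneg _
  refine columnHilbert_le hN fun w => ?_
  set T := operatorMatrix (x.map fun ξ : H => NormedSpace.inclusionInDoubleDual ℂ H ξ)
  set z : n → H := fun j => ∑ i, w i • x.transpose j i
  -- The functionals that attain the norm: `g_j` is the Riesz functional of the vector `z_j`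
  -- obtained by applying `xᵀ` to `w`.
  set g : PiLp 2 (fun _ : n => StrongDual ℂ H) := WithLp.toLp 2 fun j => innerSL ℂ (z j)
  have hT : ∀ i, T g i = ∑ j, inner ℂ (z j) (x i j) := fun i => by simp [T, operatorMatrix, g]
  set S := ∑ j, ‖z j‖ ^ 2
  have hS0 : 0 ≤ S := by positivity
  have hW0 : 0 ≤ ∑ i, ‖w i‖ ^ 2 := by positivity
  have hG : ‖g‖ = √S := by
    rw [← Real.sqrt_sq (norm_nonneg g), PiLp.norm_sq_eq_of_L2]
    simp [g, S]
  have h1 : (S : ℂ) = ∑ i, w i * T g i := by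
    simp only [hT, Finset.mul_sum]
    rw [Finset.sum_comm]
    push_cast [S]
    refine Finset.sum_congr rfl fun j _ => ?_
    have := inner_self_eq_norm_sq_to_K (𝕜 := ℂ) (z j)
    simp only [Complex.coe_algebraMap] at this
    rw [← this]
    conv_lhs => rw [show inner ℂ (z j) (z j) = inner ℂ (z j) (∑ i, w i • x i j) from rfl]
    simp only [inner_sum, inner_smul_right]
  have h2 : S ≤ √(∑ i, ‖w i‖ ^ 2) * (N * √S) := by
    calc S = ‖(S : ℂ)‖ := by rw [Complex.norm_real, Real.norm_of_nonneg hS0]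
      _ ≤ ∑ i, ‖w i‖ * ‖T g i‖ := by
          rw [h1]
          exact (norm_sum_le _ _).trans_eq (by simp only [norm_mul])
      _ ≤ √(∑ i, ‖w i‖ ^ 2) * √(∑ i, ‖T g i‖ ^ 2) := Real.sum_mul_le_sqrt_mul_sqrt _ _ _
      _ ≤ _ := by
          gcongr
          rw [← PiLp.norm_sq_eq_of_L2, Real.sqrt_sq (norm_nonneg _), ← hG]
          exact T.le_opNorm g
  change S ≤ _
  have h3 : √S ≤ N * √(∑ i, ‖w i‖ ^ 2) := by
    by_contra! hlt
    have hpos : 0 < √S := lt_of_le_of_lt (by positivity) hlt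
    nlinarith [Real.mul_self_sqrt hS0]
  calc S = √S ^ 2 := (Real.sq_sqrt hS0).symm
    _ ≤ (N * √(∑ i, ‖w i‖ ^ 2)) ^ 2 := by gcongr
    _ = _ := by rw [mul_pow, Real.sq_sqrt hW0]

variable (H) in
theorem columnHilbert_op : (columnHilbert H).op = rowHilbert H := by
  refine congrArg MatrixNorms.mk ?_
  funext m n _ _ x
  exact le_antisymm (le_rowHilbert_nrm x) (rowHilbert_nrm_le x)

variable (H) in
theorem rowHilbert_op : (rowHilbert H).op = columnHilbert H := by
  rw [← columnHilbert_op]; rfl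

theorem rowHilbert_isOperatorSpace : (rowHilbert H).IsOperatorSpace :=
  columnHilbert_op H ▸ columnHilbert_isOperatorSpace.op

theorem rowHilbert_one (ξ : H) : (rowHilbert H).one ξ = ‖ξ‖ := by
  rw [← columnHilbert_op, ← columnHilbert_one]; rfl

theorem norm_sq_smul_pair {u v : H} (h : Orthonormal ℂ ![u, v]) (a b : ℂ) :
    ‖a • u + b • v‖ ^ 2 = ‖a‖ ^ 2 + ‖b‖ ^ 2 := by
  simpa [Fin.sum_univ_two] using norm_sq_sum_smul_of_orthonormal h ![a, b]

/-- A row of two orthonormal vectors has norm at most one in the column Hilbert space. -/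
theorem columnHilbert_orthonormal_row_le {u v : H} (h : Orthonormal ℂ ![u, v]) :
    (columnHilbert H).nrm (Matrix.of fun (_ : Unit) (j : Unit × Fin 2) => ![u, v] j.2) ≤ 1 := by
  refine columnHilbert_le zero_le_one fun c => ?_
  simp [Fintype.sum_prod_type, norm_sq_smul_pair h]

/-- A column over `H_r` is, after transposition, a row over `H_c`, and an orthonormal row there is
contractive. -/
theorem rowHilbert_col_one_ne {u v : H} (h : Orthonormal ℂ ![u, v]) :
    (rowHilbert H).col.one ![u, v] ≠ √2 := by
  have h1 : (rowHilbert H).col.one ![u, v] ≤ 1 := by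
    rw [← columnHilbert_op]
    exact columnHilbert_orthonormal_row_le h
  have h2 : 1 < √2 := Real.one_lt_sqrt_two
  exact (h1.trans_lt h2).ne

/-- If the norms dominate those of the row Hilbert space, then the norm of an orthonormal pair
in `C₂[X]` is at least two. -/
theorem two_le_colProj_one {o : MatrixNorms H} (ho : o.Regular)
    (hle : ∀ {m n : Type} [Fintype m] [Fintype n] (x : Matrix m n H),
      (rowHilbert H).nrm x ≤ o.nrm x) {u v : H} (h : Orthonormal ℂ ![u, v]) :
    2 ≤ o.colProj.one ![u, v] := by
  -- The functionals `⟪u, ·⟫` and `⟪v, ·⟫` take the total value `2` on `(u, v)`, and Bessel's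
  -- inequality bounds them by `1` as a row on `H_r`.
  have key := ho.norm_le_colProj_one (fun k => (innerSL ℂ (![u, v] k)).toLinearMap) zero_lt_one
    (fun {r s} x => ?_) ![u, v]
  · have hu : ‖u‖ = 1 := h.1 0
    have hv : ‖v‖ = 1 := h.1 1
    simp [hu, hv] at key
    norm_num at key
    exact key
  · rw [one_mul]
    refine le_trans ?_ (hle x)
    rw [← columnHilbert_op]
    refine scalarOpNorm_le (columnHilbert_nonneg _) fun c => ?_
    refine le_trans ?_ (columnHilbert_bound x.transpose c)
    rw [Fintype.sum_prod_type, Finset.sum_comm]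
    refine Finset.sum_le_sum fun j _ => ?_
    refine le_of_eq_of_le ?_ (sum_norm_sq_inner_le h _)
    simp [mul_comm]

theorem two_ne_sqrt_two_of_le {t : ℝ} (h : 2 ≤ t) : t ≠ √2 := by
  have h2 : √2 < 2 := by
    rw [Real.sqrt_lt' two_pos]; norm_num
  exact (h2.trans_le h).ne'

theorem mapMatrix_comp_self {P : H →ₗ[ℂ] H} (h : P ∘ₗ P = P) (N : ℕ) :
    (P.mapMatrix : Matrix (Fin N) (Fin N) H →ₗ[ℂ] _) ∘ₗ P.mapMatrix = P.mapMatrix := by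
  ext x i j
  exact LinearMap.congr_fun h (x i j)

variable [CompleteSpace H]

variable (H) in
theorem rowHilbert_leftM : (rowHilbert H).leftM = trivialProj H :=
  rowHilbert_isOperatorSpace.regular.leftM_eq_trivialProj rowHilbert_one
    fun _ _ => rowHilbert_col_one_ne

variable (H) in
theorem rowHilbert_leftL : (rowHilbert H).leftL = trivialProj H :=
  rowHilbert_isOperatorSpace.regular.leftL_eq_trivialProj rowHilbert_one fun _ _ h =>
    two_ne_sqrt_two_of_le (two_le_colProj_one rowHilbert_isOperatorSpace.regular
      (fun _ => le_rfl) h)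

/-! ### Column Hilbert space -/

theorem norm_sq_eq_add_of_mem_orthProj {P : H →ₗ[ℂ] H} (hP : P ∈ orthProj H) (x : H) :
    ‖x‖ ^ 2 = ‖P x‖ ^ 2 + ‖x - P x‖ ^ 2 := by
  obtain ⟨h1, h2⟩ := mem_orthProj_iff.1 hP
  have h3 : P (P x) = P x := LinearMap.congr_fun h1 x
  have h4 : inner ℂ (P x) (x - P x) = 0 := by rw [h2, map_sub, h3, sub_self, inner_zero_right]
  have := norm_add_sq_eq_norm_sq_add_norm_sq_of_inner_eq_zero (P x) (x - P x) h4
  rw [add_sub_cancel] at this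
  rw [sq, this, sq, sq]

theorem columnHilbert_col_splitMap {P : H →ₗ[ℂ] H} (hP : P ∈ orthProj H) {m n : Type} [Fintype m]
    [Fintype n] (x : Matrix m n H) :
    (columnHilbert H).col.nrm (x.map (splitMap P)) = (columnHilbert H).nrm x := by
  have e : ∀ v : n → ℂ, ∑ i : m × Fin 2, ‖∑ j, v j • splitMap P (x i.1 j) i.2‖ ^ 2 =
      ∑ i, ‖∑ j, v j • x i j‖ ^ 2 := by
    intro v
    rw [Fintype.sum_prod_type]
    refine Finset.sum_congr rfl fun i _ => ?_
    rw [norm_sq_eq_add_of_mem_orthProj hP]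
    simp [splitMap, smul_sub]
  change (columnHilbert H).nrm
    (Matrix.of fun (i : m × Fin 2) (j : n) => splitMap P (x i.1 j) i.2) = _
  refine le_antisymm (columnHilbert_le_of_forall_le fun v => ?_)
    (columnHilbert_le_of_forall_le fun v => ?_)
  · simpa only [Matrix.of_apply] using (e v).le
  · simpa only [Matrix.of_apply] using (e v).ge

variable (H) in
theorem columnHilbert_completeLeftM : (columnHilbert H).completeLeftM = orthProj H := by
  refine Set.Subset.antisymm (columnHilbert_regular.completeLeftM_subset.trans
    (columnHilbert_regular.leftM_subset columnHilbert_one)) fun P hP N => ?_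
  refine ⟨mapMatrix_comp_self (mem_orthProj_iff.1 hP).1 N, fun X => ?_⟩
  have h1 := columnHilbert_col_splitMap hP (Matrix.comp Unit Unit (Fin N) (Fin N) H
    (Matrix.of fun _ _ => X))
  -- Columns over `M_N(H_c)` are matrices over `H_c` whose column index comes before the index in
  -- `Fin N`; the two are interchanged here.
  let f : (Unit × Fin 2) × Fin N ≃ (Unit × Fin N) × Fin 2 :=
    ⟨fun i => ((i.1.1, i.2), i.1.2), fun i => ((i.1.1, i.2), i.1.2), fun _ => rfl, fun _ => rfl⟩
  have h2 := columnHilbert_regular.nrm_submatrix_equiv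
    (Matrix.of fun (i : (Unit × Fin N) × Fin 2) (j : Unit × Fin N) =>
      splitMap P (X i.1.2 j.2) i.2) f (Equiv.refl _)
  refine (h1.symm.trans (h2.symm.trans (congrArg (columnHilbert H).nrm ?_)))
  ext ⟨⟨i, k⟩, a⟩ ⟨j, b⟩
  fin_cases k <;> rfl

variable (H) in
theorem columnHilbert_leftM : (columnHilbert H).leftM = orthProj H :=
  Set.Subset.antisymm (columnHilbert_regular.leftM_subset columnHilbert_one)
    ((columnHilbert_completeLeftM H).superset.trans columnHilbert_regular.completeLeftM_subset)

/-- Stated for any norms below those of `H_c`, so that it also serves `MIN(H)`. The entries of `P x`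
and of `x - P x` are expanded in orthonormal bases `b`, `b'` of their spans, which together form an
orthonormal family `e`. -/
theorem colProj_splitMap_le {o : MatrixNorms H} (ho : o.Regular)
    (hle : ∀ {m n : Type} [Fintype m] [Fintype n] (x : Matrix m n H),
      o.nrm x ≤ (columnHilbert H).nrm x) {P : H →ₗ[ℂ] H} (hP : P ∈ orthProj H)
    {m n : Type} [Fintype m] [Fintype n] (x : Matrix m n H) :
    o.colProj.nrm (x.map (splitMap P)) ≤ (columnHilbert H).nrm x := by
  classical
  obtain ⟨hP1, hP2⟩ := mem_orthProj_iff.1 hP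
  have hPP : ∀ x, P (P x) = P x := fun x => LinearMap.congr_fun hP1 x
  obtain ⟨d, b, hb, hbm, hbs⟩ := exists_orthonormal_span fun i : m × n => P (x i.1 i.2)
  obtain ⟨d', b', hb', hbm', hbs'⟩ :=
    exists_orthonormal_span fun i : m × n => x i.1 i.2 - P (x i.1 i.2)
  have hPb : ∀ k, P (b k) = b k := fun k => by
    have : Submodule.span ℂ (Set.range fun i : m × n => P (x i.1 i.2)) ≤
        LinearMap.eqLocus P LinearMap.id := by
      rw [Submodule.span_le]
      rintro _ ⟨i, rfl⟩
      exact hPP _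
    exact this (hbm k)
  have hPb' : ∀ k, P (b' k) = 0 := fun k => by
    have : Submodule.span ℂ (Set.range fun i : m × n => x i.1 i.2 - P (x i.1 i.2)) ≤
        LinearMap.ker P := by
      rw [Submodule.span_le]
      rintro _ ⟨i, rfl⟩
      simp [hPP]
    exact this (hbm' k)
  have hbb : ∀ k l, inner ℂ (b k) (b' l) = 0 := fun k l => by
    rw [← hPb, hP2, hPb', inner_zero_right]
  let e : Fin d ⊕ Fin d' → H := Sum.elim b b'
  have he : Orthonormal ℂ e := by
    refine ⟨?_, ?_⟩
    · rintro (k | k)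
      exacts [hb.1 k, hb'.1 k]
    · rintro (k | k) (l | l) hkl
      · exact hb.2 fun h => hkl (congrArg _ h)
      · exact hbb k l
      · change inner ℂ (b' k) (b l) = 0
        rw [← inner_conj_symm, hbb, map_zero]
      · exact hb'.2 fun h => hkl (congrArg _ h)
  -- Every row of `y` contains its own copy of `e`, so `y` is isometric. The coefficients of `x`,
  -- sorted by component, go into `β`, which Pythagoras and Bessel bound by the column norm of `x`.
  let y : Matrix m (m × (Fin d ⊕ Fin d')) H := Matrix.of fun i l => if i = l.1 then e l.2 else 0
  have hy : (columnHilbert H).nrm y ≤ 1 := by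
    refine columnHilbert_le zero_le_one fun c => le_of_eq ?_
    have : ∀ i, ∑ l, c l • y i l = ∑ k, c (i, k) • e k := fun i => by
      simp [y, Fintype.sum_prod_type (α₁ := m)]
    simp only [this, norm_sq_sum_smul_of_orthonormal he]
    rw [one_pow, one_mul, Fintype.sum_prod_type]
  let β : Matrix (Fin 2 × (m × (Fin d ⊕ Fin d'))) n ℂ := Matrix.of fun l j =>
    Sum.elim (fun k => if l.1 = 0 then inner ℂ (b k) (P (x l.2.1 j)) else 0)
      (fun k => if l.1 = 1 then inner ℂ (b' k) (x l.2.1 j - P (x l.2.1 j)) else 0) l.2.2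
  have hβ : scalarOpNorm β ≤ (columnHilbert H).nrm x := by
    refine scalarOpNorm_le (columnHilbert_nonneg x) fun c => ?_
    refine le_trans ?_ (columnHilbert_bound x c)
    rw [Fintype.sum_prod_type, Fin.sum_univ_two, Fintype.sum_prod_type, Fintype.sum_prod_type,
      ← Finset.sum_add_distrib]
    refine Finset.sum_le_sum fun i _ => ?_
    rw [norm_sq_eq_add_of_mem_orthProj hP]
    refine add_le_add ?_ ?_
    · refine le_of_eq_of_le ?_ (sum_norm_sq_inner_le hb _)
      simp [β, mul_comm]
    · refine le_of_eq_of_le ?_ (sum_norm_sq_inner_le hb' _)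
      simp only [map_sum, map_smul, ← Finset.sum_sub_distrib, ← smul_sub]
      simp [β, mul_comm]
  refine (ho.colProj_le y β fun i j k => ?_).trans ?_
  · have e1 := hbs _ (Submodule.subset_span ⟨(i, j), rfl⟩)
    have e2 := hbs' _ (Submodule.subset_span ⟨(i, j), rfl⟩)
    have : ∀ k, ∑ l, β (k, l) j • y i l = ∑ l, β (k, (i, l)) j • e l := fun k => by
      simp [y, Fintype.sum_prod_type (α₁ := m)]
    rw [this, Fintype.sum_sum_type]
    fin_cases k
    · simpa [β, e, splitMap] using e1
    · simpa [β, e, splitMap] using e2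
  · have h1 := hle y
    calc _ ≤ 1 * (columnHilbert H).nrm x :=
          mul_le_mul (h1.trans hy) hβ (scalarOpNorm_nonneg β) zero_le_one
      _ = _ := one_mul _

variable (H) in
theorem columnHilbert_completeLeftL : (columnHilbert H).completeLeftL = orthProj H := by
  refine Set.Subset.antisymm (columnHilbert_regular.completeLeftL_subset.trans
    (columnHilbert_regular.leftL_subset columnHilbert_one)) fun P hP => ?_
  obtain ⟨hP1, hP2⟩ := mem_orthProj_iff.1 hP
  have hPP : ∀ x, P (P x) = P x := fun x => LinearMap.congr_fun hP1 x
  refine ⟨hP1, fun N x => le_antisymm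
    (colProj_splitMap_le columnHilbert_regular (fun _ => le_rfl) hP x) ?_⟩
  -- The map `(a, b) ↦ P a + (b - P b)` recovers `x` from its splitting and is contractive as a row,
  -- because the two ranges are orthogonal.
  have key := columnHilbert_regular.columnHilbert_le_colProj ![P, LinearMap.id - P] zero_lt_one
    (fun {r s} x ζ => ?_) (x.map (splitMap P))
  · rw [one_mul] at key
    refine le_of_eq_of_le (congrArg (columnHilbert H).nrm ?_) key
    ext i j
    simp [splitMap, hPP]
  · rw [one_mul, Fin.sum_univ_two, mul_add]
    refine le_trans ?_ (add_le_add (columnHilbert_bound x (ζ 0)) (columnHilbert_bound x (ζ 1)))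
    rw [← Finset.sum_add_distrib]
    refine Finset.sum_le_sum fun i _ => ?_
    set a := ∑ j, ζ 0 j • x i j with ha
    set b := ∑ j, ζ 1 j • x i j with hb
    have e : ∑ k, ∑ j, ζ k j • (![P, LinearMap.id - P] : Fin 2 → H →ₗ[ℂ] H) k (x i j) =
        P a + (b - P b) := by
      simp [Fin.sum_univ_two, ha, hb, smul_sub]
    rw [e, norm_sq_eq_add_of_mem_orthProj hP (P a + (b - P b)),
      norm_sq_eq_add_of_mem_orthProj hP a, norm_sq_eq_add_of_mem_orthProj hP b]
    simp only [map_add, map_sub, hPP, sub_self, add_zero, add_sub_cancel_left]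
    nlinarith [sq_nonneg ‖a - P a‖, sq_nonneg ‖P b‖]

variable (H) in
theorem columnHilbert_leftL : (columnHilbert H).leftL = orthProj H :=
  Set.Subset.antisymm (columnHilbert_regular.leftL_subset columnHilbert_one)
    ((columnHilbert_completeLeftL H).superset.trans columnHilbert_regular.completeLeftL_subset)

end Hilbert

section Hilbert

variable {H : Type*} [NormedAddCommGroup H] [InnerProductSpace ℂ H]

/-! ### Pisier's operator Hilbert space -/

/-- The matrix of all inner products of entries of a matrix of vectors. -/
noncomputable def gram {m n : Type} (x : Matrix m n H) : Matrix (m × m) (n × n) ℂ :=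
  Matrix.of fun i j => inner ℂ (x i.1 j.1) (x i.2 j.2)

theorem scalarOpNorm_conj_kron_le {m n : Type} [Fintype m] [Fintype n] (α : Matrix m n ℂ) :
    scalarOpNorm (Matrix.of fun (i : m × m) (j : n × n) =>
      starRingEnd ℂ (α i.1 j.1) * α i.2 j.2) ≤ scalarOpNorm α ^ 2 := by
  refine (scalars_regular.nrm_kron_le (α.map (starRingEnd ℂ)) α).trans ?_
  rw [sq]
  exact mul_le_mul_of_nonneg_right (scalarOpNorm_map_conj_le α) (scalarOpNorm_nonneg α)

/-- By sesquilinearity the scalar factors enter as `ᾱ ⊗ α` and `β̄ ⊗ β`. Their norms are at most the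
squares, and the square root in the norm of `H_o` undoes this. -/
theorem gram_bimul {p m n q : Type} [Fintype m] [Fintype n] (α : Matrix p m ℂ)
    (x : Matrix m n H) (β : Matrix n q ℂ) :
    gram (Matrix.bimul α x β) = Matrix.bimul
      (Matrix.of fun (i : p × p) (j : m × m) => starRingEnd ℂ (α i.1 j.1) * α i.2 j.2) (gram x)
      (Matrix.of fun (i : n × n) (j : q × q) => starRingEnd ℂ (β i.1 j.1) * β i.2 j.2) := by
  ext i j
  simp only [gram, Matrix.bimul, Matrix.of_apply]
  rw [Fintype.sum_prod_type, sum_inner]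
  refine Finset.sum_congr rfl fun k _ => ?_
  rw [inner_sum]
  refine Finset.sum_congr rfl fun k' _ => ?_
  rw [Fintype.sum_prod_type, sum_inner]
  refine Finset.sum_congr rfl fun l _ => ?_
  rw [inner_sum]
  refine Finset.sum_congr rfl fun l' _ => ?_
  simp only [inner_smul_left, inner_smul_right, smul_eq_mul, map_mul]
  ring

theorem operatorHilbert_regular : (operatorHilbert H).Regular where
  nonneg x := Real.sqrt_nonneg _
  bimul_le {p m n q} _ _ _ _ α x β := by
    have h1 := scalarOpNorm_nonneg α
    have h2 := scalarOpNorm_nonneg β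
    have h3 := scalarOpNorm_nonneg (gram x)
    change √(scalarOpNorm (gram (Matrix.bimul α x β))) ≤
      scalarOpNorm α * √(scalarOpNorm (gram x)) * scalarOpNorm β
    rw [Real.sqrt_le_left (by positivity), gram_bimul]
    refine (scalars_regular.bimul_le _ _ _).trans ?_
    calc _ ≤ scalarOpNorm α ^ 2 * scalarOpNorm (gram x) * scalarOpNorm β ^ 2 :=
          mul_le_mul (mul_le_mul_of_nonneg_right (scalarOpNorm_conj_kron_le α) h3)
            (scalarOpNorm_conj_kron_le β) (scalarOpNorm_nonneg _) (by positivity)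
      _ = _ := by rw [mul_pow, mul_pow, Real.sq_sqrt h3]
  amp_le {m n} _ _ k x := by
    refine Real.sqrt_le_sqrt ?_
    have hinj : ∀ l : Type, Function.Injective (fun i : (Fin k × l) × (Fin k × l) =>
        ((i.1.1, i.2.1), (i.1.2, i.2.2))) := by
      rintro l ⟨⟨a, b⟩, ⟨c, d⟩⟩ ⟨⟨a', b'⟩, ⟨c', d'⟩⟩ h
      simp_all
    have e : gram (ampMatrix (Fin k) x) = (ampMatrix (Fin k × Fin k) (gram x)).submatrix
        (fun i => ((i.1.1, i.2.1), (i.1.2, i.2.2))) (fun i => ((i.1.1, i.2.1), (i.1.2, i.2.2))) := by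
      ext ⟨⟨a, b⟩, ⟨c, d⟩⟩ ⟨⟨a', b'⟩, ⟨c', d'⟩⟩
      by_cases h1 : a = a' <;> by_cases h2 : c = c' <;> simp [gram, ampMatrix, h1, h2]
    change scalarOpNorm (gram (ampMatrix (Fin k) x)) ≤ scalarOpNorm (gram x)
    rw [e]
    exact (scalarOpNorm_submatrix_le _ (hinj m) (hinj n)).trans (scalarOpNorm_ampMatrix_le _ _)

theorem operatorHilbert_one (ξ : H) : (operatorHilbert H).one ξ = ‖ξ‖ := by
  have : Unique (Unit × Unit) := ⟨⟨((), ())⟩, fun _ => rfl⟩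
  have h := scalarOpNorm_of_const (m := Unit × Unit) (n := Unit × Unit) (inner ℂ ξ ξ)
  refine (congrArg Real.sqrt h).trans ?_
  rw [inner_self_eq_norm_sq_to_K]
  simp

variable (H) in
theorem operatorHilbert_op : (operatorHilbert H).op = operatorHilbert H := by
  refine congrArg MatrixNorms.mk ?_
  funext m n _ _ x
  exact congrArg Real.sqrt (scalarOpNorm_transpose (gram x))

theorem operatorHilbert_col_one_ne {u v : H} (h : Orthonormal ℂ ![u, v]) :
    (operatorHilbert H).col.one ![u, v] ≠ √2 := by
  -- The Gram matrix is the column `(1, 0, 0, 1)`, of norm `√2`; the norm in `H_o` is its square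
  -- root, at most `2^(1/4) < √2`.
  have h1 : scalarOpNorm (gram (Matrix.of fun (i : Unit × Fin 2) (_ : Unit) => ![u, v] i.2)) ≤
      √2 := by
    refine scalarOpNorm_le (Real.sqrt_nonneg _) fun c => ?_
    have hu : ‖u‖ = 1 := h.1 0
    have hv : ‖v‖ = 1 := h.1 1
    have huv : inner ℂ u v = 0 := h.2 (show (0 : Fin 2) ≠ 1 by decide)
    have hvu : inner ℂ v u = 0 := h.2 (show (1 : Fin 2) ≠ 0 by decide)
    simp [gram, Fintype.sum_prod_type, hu, hv, huv, hvu]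
    linarith
  have h2 : 1 < √2 := Real.one_lt_sqrt_two
  refine ((Real.sqrt_le_sqrt h1).trans_lt ?_).ne
  rw [Real.sqrt_lt' (by positivity)]
  nlinarith

/-- Two orthonormal functionals are bounded by `2 ^ (1/4)` as a row on `H_o`. -/
theorem operatorHilbert_row_le {u v : H} (h : Orthonormal ℂ ![u, v]) {m n : Type} [Fintype m]
    [Fintype n] (x : Matrix m n H) :
    scalarOpNorm (Matrix.of fun (l : Fin 2 × n) (i : m) => inner ℂ (![u, v] l.1) (x i l.2)) ≤
      √(√2) * (operatorHilbert H).nrm x := by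
  have hN := scalarOpNorm_nonneg (gram x)
  refine scalarOpNorm_le (mul_nonneg (Real.sqrt_nonneg _) (Real.sqrt_nonneg _)) fun c => ?_
  change _ ≤ (√(√2) * √(scalarOpNorm (gram x))) ^ 2 * _
  rw [mul_pow, Real.sq_sqrt (Real.sqrt_nonneg _), Real.sq_sqrt hN]
  set N := scalarOpNorm (gram x)
  -- Here `w 0`, `w 1` are the conjugated blocks of the output to be bounded. The vectors `z l` are
  -- chosen so that `⟪u_k, z l⟫` is the Gram matrix `a k l` of the `w`'s, where `(u_0, u_1) = (u,
  -- v)`; its squared Hilbert–Schmidt norm is `Q`.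
  set w : Fin 2 → n → ℂ := fun k j => starRingEnd ℂ (∑ i, inner ℂ (![u, v] k) (x i j) * c i) with hw
  set z : Fin 2 → H := fun l => ∑ i, ∑ j, (c i * w l j) • x i j with hz
  set a : Fin 2 → Fin 2 → ℂ := fun k l => ∑ j, w l j * starRingEnd ℂ (w k j) with ha
  set V : n × n → ℂ := fun j => ∑ l, starRingEnd ℂ (w l j.1) * w l j.2 with hV
  set Q : ℝ := ∑ l, ∑ k, ‖a k l‖ ^ 2 with hQ
  have hQ0 : 0 ≤ Q := by positivity
  have haz : ∀ k l, inner ℂ (![u, v] k) (z l) = a k l := by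
    intro k l
    simp only [hz, ha, inner_sum, inner_smul_right]
    rw [Finset.sum_comm]
    refine Finset.sum_congr rfl fun j _ => ?_
    simp only [hw, RingHomCompTriple.comp_apply, RingHom.id_apply, Finset.mul_sum]
    exact Finset.sum_congr rfl fun i _ => by ring
  have h1 : Q ≤ ∑ l, ‖z l‖ ^ 2 := by
    refine Finset.sum_le_sum fun l _ => ?_
    simp only [← haz]
    exact sum_norm_sq_inner_le h (z l)
  have hVQ : ∑ j, ‖V j‖ ^ 2 = Q := by
    apply Complex.ofReal_injective
    rw [hQ]
    push_cast
    simp only [← Complex.conj_mul', hV, ha, map_sum, map_mul, Complex.conj_conj,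
      Fintype.sum_prod_type, Finset.sum_mul_sum]
    simp only [Fin.sum_univ_two, ← Finset.sum_add_distrib]
    refine Finset.sum_congr rfl fun j _ => Finset.sum_congr rfl fun j' _ => ?_
    ring
  have h2 : ((∑ l, ‖z l‖ ^ 2 : ℝ) : ℂ) =
      ∑ i : m × m, (starRingEnd ℂ (c i.1) * c i.2) * ∑ j, gram x i j * V j := by
    push_cast
    have : ∀ l, ((‖z l‖ : ℂ)) ^ 2 = inner ℂ (z l) (z l) := fun l =>
      (inner_self_eq_norm_sq_to_K (𝕜 := ℂ) (z l)).symm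
    have hzz : ∀ l, inner ℂ (z l) (z l) = ∑ i, ∑ i', ∑ j, ∑ j', (starRingEnd ℂ (c i) * c i') *
        (inner ℂ (x i j) (x i' j') * (starRingEnd ℂ (w l j) * w l j')) := fun l => by
      simp only [hz]
      rw [sum_inner]
      refine Finset.sum_congr rfl fun i _ => ?_
      rw [inner_sum]
      refine Finset.sum_congr rfl fun i' _ => ?_
      rw [sum_inner]
      refine Finset.sum_congr rfl fun j _ => ?_
      rw [inner_sum]
      refine Finset.sum_congr rfl fun j' _ => ?_
      simp only [inner_smul_left, inner_smul_right, map_mul]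
      ring
    simp only [this, hzz, hV, gram, Fintype.sum_prod_type, Matrix.of_apply]
    simp only [Fin.sum_univ_two, ← Finset.sum_add_distrib, Finset.mul_sum]
    refine Finset.sum_congr rfl fun i _ => Finset.sum_congr rfl fun i' _ =>
      Finset.sum_congr rfl fun j _ => Finset.sum_congr rfl fun j' _ => ?_
    ring
  -- `∑ ‖z l‖²` is the form of `gram x` at `c̄ ⊗ c` and `V`, where `‖V‖² = Q`. With Bessel's `Q ≤ ∑
  -- ‖z l‖²` this yields `√Q ≤ D`.
  have h3 : ∑ l, ‖z l‖ ^ 2 ≤ (∑ i, ‖c i‖ ^ 2) * (N * √Q) := by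
    have h4 := norm_sum_mul_le_scalarOpNorm (gram x)
      (fun i => starRingEnd ℂ (c i.1) * c i.2) V
    rw [← h2, Complex.norm_real, Real.norm_of_nonneg (by positivity), hVQ] at h4
    refine h4.trans_eq ?_
    congr 1
    simp only [norm_mul, RCLike.norm_conj, mul_pow, Fintype.sum_prod_type, ← Finset.mul_sum,
      ← Finset.sum_mul]
    exact Real.sqrt_mul_self (by positivity)
  set D := N * ∑ i, ‖c i‖ ^ 2 with hD
  have hD0 : 0 ≤ D := by positivity
  have h5 : √Q ≤ D := by
    by_contra! hlt
    have hpos : 0 < √Q := lt_of_le_of_lt hD0 hlt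
    nlinarith [Real.mul_self_sqrt hQ0]
  have h6 : Q ≤ D ^ 2 := by
    rw [← Real.sq_sqrt hQ0]; gcongr
  have hakk : ∀ k, ‖a k k‖ = ∑ j, ‖w k j‖ ^ 2 := fun k => by
    have : a k k = ((∑ j, ‖w k j‖ ^ 2 : ℝ) : ℂ) := by
      simp only [ha, Complex.mul_conj']
      push_cast
      rfl
    rw [this, Complex.norm_real, Real.norm_of_nonneg (by positivity)]
  -- Only the diagonal of `a` is kept. Passing from `s² + t² ≤ D²` to `s + t ≤ √2 D` is the source
  -- of the constant: `√2` for squares, `2^(1/4)` for norms.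
  have h7 : (∑ j, ‖w 0 j‖ ^ 2) ^ 2 + (∑ j, ‖w 1 j‖ ^ 2) ^ 2 ≤ Q := by
    rw [← hakk, ← hakk, hQ]
    simp only [Fin.sum_univ_two]
    nlinarith [sq_nonneg ‖a 0 1‖, sq_nonneg ‖a 1 0‖]
  have h8 : ∑ l : Fin 2 × n, ‖∑ i, (Matrix.of fun (l : Fin 2 × n) (i : m) =>
      inner ℂ (![u, v] l.1) (x i l.2)) l i * c i‖ ^ 2 =
      ∑ j, ‖w 0 j‖ ^ 2 + ∑ j, ‖w 1 j‖ ^ 2 := by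
    rw [Fintype.sum_prod_type, Fin.sum_univ_two]
    simp only [hw, RCLike.norm_conj]
    rfl
  rw [h8, mul_assoc, ← hD]
  refine le_of_sq_le_sq ?_ (by positivity)
  rw [mul_pow, Real.sq_sqrt zero_le_two]
  nlinarith [sq_nonneg (∑ j, ‖w 0 j‖ ^ 2 - ∑ j, ‖w 1 j‖ ^ 2)]

theorem operatorHilbert_colProj_one_ne {u v : H} (h : Orthonormal ℂ ![u, v]) :
    (operatorHilbert H).colProj.one ![u, v] ≠ √2 := by
  have key := operatorHilbert_regular.norm_le_colProj_one
    (fun k => (innerSL ℂ (![u, v] k)).toLinearMap) (C := √(√2)) (by positivity)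
    (fun x => operatorHilbert_row_le h x) ![u, v]
  intro heq
  have hu : ‖u‖ = 1 := h.1 0
  have hv : ‖v‖ = 1 := h.1 1
  rw [heq] at key
  simp [hu, hv] at key
  norm_num at key
  -- If the norm were `√2`, then `2 ≤ 2^(1/4) √2`, that is `4 ≤ 2 √2` after squaring.
  have h1 := pow_le_pow_left₀ zero_le_two key 2
  rw [mul_pow, Real.sq_sqrt (Real.sqrt_nonneg _), Real.sq_sqrt zero_le_two] at h1
  have h2 : √2 < 2 := by rw [Real.sqrt_lt' two_pos]; norm_num
  linarith

/-! ### The minimal quantization -/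

/-- Contractive functionals are completely contractive on `H_c`. This also makes the supremum
defining `MIN(H)` finite. -/
theorem scalarOpNorm_map_dual_le {f : StrongDual ℂ H} (hf : ‖f‖ ≤ 1) {m n : Type} [Fintype m]
    [Fintype n] (x : Matrix m n H) : scalarOpNorm (x.map f) ≤ (columnHilbert H).nrm x := by
  refine scalarOpNorm_le (columnHilbert_nonneg x) fun c => ?_
  refine le_trans (Finset.sum_le_sum fun i _ => ?_) (columnHilbert_bound x c)
  have e : ∑ j, x.map f i j * c j = f (∑ j, c j • x i j) := by
    simp [mul_comm]
  rw [e]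
  have := f.le_of_opNorm_le hf (∑ j, c j • x i j)
  rw [one_mul] at this
  gcongr

theorem scalarOpNorm_map_le_minHilbert {f : StrongDual ℂ H} (hf : ‖f‖ ≤ 1) {m n : Type}
    [Fintype m] [Fintype n] (x : Matrix m n H) :
    scalarOpNorm (x.map f) ≤ (minHilbert H).nrm x := by
  refine le_csSup ⟨(columnHilbert H).nrm x, ?_⟩ ⟨f, hf, rfl⟩
  rintro _ ⟨f, hf, rfl⟩
  exact scalarOpNorm_map_dual_le hf x

theorem minHilbert_le {m n : Type} [Fintype m] [Fintype n] {x : Matrix m n H} {C : ℝ}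
    (h : ∀ f : StrongDual ℂ H, ‖f‖ ≤ 1 → scalarOpNorm (x.map f) ≤ C) :
    (minHilbert H).nrm x ≤ C := by
  refine csSup_le ⟨_, 0, by simp, rfl⟩ ?_
  rintro _ ⟨f, hf, rfl⟩
  exact h f hf

theorem minHilbert_le_columnHilbert {m n : Type} [Fintype m] [Fintype n] (x : Matrix m n H) :
    (minHilbert H).nrm x ≤ (columnHilbert H).nrm x :=
  minHilbert_le fun _ hf => scalarOpNorm_map_dual_le hf x

theorem minHilbert_nonneg {m n : Type} [Fintype m] [Fintype n] (x : Matrix m n H) :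
    0 ≤ (minHilbert H).nrm x :=
  (scalarOpNorm_nonneg _).trans (scalarOpNorm_map_le_minHilbert (f := 0) (by simp) x)

theorem minHilbert_regular : (minHilbert H).Regular where
  nonneg := minHilbert_nonneg
  bimul_le α x β := by
    refine minHilbert_le fun f hf => ?_
    have e := map_bimul f.toLinearMap α x β
    have h1 := scalarOpNorm_nonneg α
    have h2 := scalarOpNorm_nonneg β
    refine (le_of_eq_of_le (congrArg scalarOpNorm e) (scalars_regular.bimul_le _ _ _)).trans ?_
    gcongr
    exact scalarOpNorm_map_le_minHilbert hf x
  amp_le k x := by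
    refine minHilbert_le fun f hf => ?_
    refine le_trans (le_of_eq_of_le (congrArg scalarOpNorm ?_)
      (scalarOpNorm_ampMatrix_le (Fin k) (x.map f))) (scalarOpNorm_map_le_minHilbert hf x)
    ext i j
    by_cases h : i.1 = j.1 <;> simp [ampMatrix, h]

theorem minHilbert_one (ξ : H) : (minHilbert H).one ξ = ‖ξ‖ := by
  refine le_antisymm ((minHilbert_le_columnHilbert _).trans_eq (columnHilbert_one ξ)) ?_
  obtain ⟨f, hf, hfx⟩ := exists_dual_vector'' ℂ ξ
  have h := scalarOpNorm_map_le_minHilbert hf (Matrix.of fun (_ _ : Unit) => ξ)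
  refine le_trans ?_ h
  have h2 := scalarOpNorm_of_const (m := Unit) (n := Unit) (f ξ)
  rw [hfx] at h2
  refine le_trans ?_ (h2.symm.trans (congrArg scalarOpNorm ?_)).le
  · simp
  · ext i j
    simp [hfx]

variable (H) in
theorem minHilbert_op : (minHilbert H).op = minHilbert H := by
  refine congrArg MatrixNorms.mk ?_
  funext m n _ _ x
  have e : ∀ f : StrongDual ℂ H, scalarOpNorm (x.transpose.map f) = scalarOpNorm (x.map f) :=
    fun f => scalarOpNorm_transpose (x.map f)
  change sSup {t : ℝ | ∃ f : StrongDual ℂ H, ‖f‖ ≤ 1 ∧ t = scalarOpNorm (x.transpose.map f)} =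
    sSup {t : ℝ | ∃ f : StrongDual ℂ H, ‖f‖ ≤ 1 ∧ t = scalarOpNorm (x.map f)}
  simp only [e]

theorem minHilbert_inner_bound (w : H) {m n : Type} [Fintype m] [Fintype n] (x : Matrix m n H)
    (c : n → ℂ) : ∑ i, ‖∑ j, inner ℂ w (x i j) * c j‖ ^ 2 ≤
      ‖w‖ ^ 2 * ((minHilbert H).nrm x ^ 2 * ∑ j, ‖c j‖ ^ 2) := by
  rcases eq_or_ne w 0 with rfl | hw
  · simp
  have hw0 : (‖w‖ : ℂ) ≠ 0 := by exact_mod_cast norm_ne_zero_iff.2 hw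
  set f : StrongDual ℂ H := innerSL ℂ ((‖w‖⁻¹ : ℂ) • w)
  have hf : ‖f‖ ≤ 1 := by simp [f, norm_smul, hw]
  have h1 := scalarOpNorm_bound (x.map f) c
  have h2 := scalarOpNorm_map_le_minHilbert hf x
  have e : ∀ i, ∑ j, inner ℂ w (x i j) * c j = (‖w‖ : ℂ) * ∑ j, x.map f i j * c j := by
    intro i
    rw [Finset.mul_sum]
    refine Finset.sum_congr rfl fun j _ => ?_
    simp only [f, Matrix.map_apply, innerSL_apply_apply, inner_smul_left, map_inv₀,
      Complex.conj_ofReal]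
    field_simp
  simp only [e, norm_mul, mul_pow, ← Finset.mul_sum, Complex.norm_real, norm_norm]
  have h3 := scalarOpNorm_nonneg (x.map f)
  gcongr
  exact h1.trans (by gcongr)

/-- The two blocks of the row are bounded separately, each by the norm of its vector; transposing
`x` costs nothing in `MIN(H)`. -/
theorem minHilbert_inner_row_le (w : Fin 2 → H) {m n : Type} [Fintype m] [Fintype n]
    (x : Matrix m n H) :
    scalarOpNorm (Matrix.of fun (l : Fin 2 × n) (i : m) => inner ℂ (w l.1) (x i l.2)) ≤
      √(‖w 0‖ ^ 2 + ‖w 1‖ ^ 2) * (minHilbert H).nrm x := by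
  have h0 := minHilbert_nonneg x
  refine scalarOpNorm_le (by positivity) fun c => ?_
  rw [Fintype.sum_prod_type, Fin.sum_univ_two, mul_pow, Real.sq_sqrt (by positivity), add_mul,
    add_mul, mul_assoc, mul_assoc]
  have h1 : (minHilbert H).nrm x.transpose = (minHilbert H).nrm x :=
    congrArg (fun o : MatrixNorms H => o.nrm x) (minHilbert_op H)
  rw [← h1]
  exact add_le_add (minHilbert_inner_bound (w 0) x.transpose c)
    (minHilbert_inner_bound (w 1) x.transpose c)

/-- The map `e_k ⊗ x ↦ ⟪u_k, x⟫ e_k`, with `(u_0, u_1) = (u, v)`, takes values in orthogonal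
directions, so its row bound only needs each unit functional to be contractive on `MIN(H)`. -/
theorem columnHilbert_le_minHilbert_colProj {u v : H} (h : Orthonormal ℂ ![u, v]) {n : Type} [Fintype n]
    {m : Type} [Fintype m] (w : Matrix m n (Fin 2 → H)) :
    (columnHilbert (EuclideanSpace ℂ (Fin 2))).nrm (Matrix.of fun i j =>
      ∑ k, inner ℂ (![u, v] k) (w i j k) • EuclideanSpace.single k (1 : ℂ)) ≤
      (minHilbert H).colProj.nrm w := by
  have hn : ∀ k, ‖(![u, v] : Fin 2 → H) k‖ = 1 := h.1
  have key := minHilbert_regular.columnHilbert_le_colProj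
    (fun k => (innerSL ℂ (![u, v] k)).toLinearMap.smulRight (EuclideanSpace.single k (1 : ℂ)))
    zero_lt_one (fun {r s} x ζ => ?_) w
  · rw [one_mul] at key
    exact key
  · have e : ∀ i, ∑ k, ∑ j, ζ k j • (innerSL ℂ (![u, v] k)).toLinearMap.smulRight
        (EuclideanSpace.single k (1 : ℂ)) (x i j) =
        ∑ k, (∑ j, inner ℂ (![u, v] k) (x i j) * ζ k j) • EuclideanSpace.single k (1 : ℂ) := by
      intro i
      refine Finset.sum_congr rfl fun k _ => ?_
      rw [Finset.sum_smul]
      refine Finset.sum_congr rfl fun j _ => ?_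
      rw [mul_comm, mul_smul]
      rfl
    simp only [e, norm_sq_sum_smul_of_orthonormal
      (EuclideanSpace.orthonormal_single (𝕜 := ℂ) (ι := Fin 2))]
    rw [Finset.sum_comm, Finset.mul_sum]
    refine Finset.sum_le_sum fun k _ => ?_
    refine (minHilbert_inner_bound (![u, v] k) x (ζ k)).trans_eq ?_
    rw [hn, one_pow, one_mul, one_mul]

variable [CompleteSpace H]

theorem sum_norm_sq_dual_le {f : StrongDual ℂ H} (hf : ‖f‖ ≤ 1) {ι : Type*} [Fintype ι]
    {b : ι → H} (hb : Orthonormal ℂ b) : ∑ k, ‖f (b k)‖ ^ 2 ≤ 1 := by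
  obtain ⟨y, rfl⟩ := (InnerProductSpace.toDual ℂ H).surjective f
  rw [LinearIsometryEquiv.norm_map] at hf
  simp only [InnerProductSpace.toDual_apply_apply]
  simp only [norm_inner_symm y]
  exact (sum_norm_sq_inner_le hb y).trans (pow_le_one₀ (norm_nonneg y) hf)

theorem minHilbert_col_one_ne {u v : H} (h : Orthonormal ℂ ![u, v]) :
    (minHilbert H).col.one ![u, v] ≠ √2 := by
  have h1 : (minHilbert H).col.one ![u, v] ≤ 1 := by
    -- A contractive functional has `|f u|² + |f v|² ≤ 1`, so the column `(f u, f v)` is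
    -- contractive.
    refine minHilbert_le fun f hf => scalarOpNorm_le zero_le_one fun c => ?_
    have h2 := sum_norm_sq_dual_le hf h
    rw [Fin.sum_univ_two] at h2
    simp only [Matrix.cons_val_zero, Matrix.cons_val_one] at h2
    simp [Fintype.sum_prod_type, mul_pow, ← add_mul]
    exact mul_le_of_le_one_left (sq_nonneg _) h2
  exact (h1.trans_lt Real.one_lt_sqrt_two).ne

variable (H) in
theorem minHilbert_leftM : (minHilbert H).leftM = trivialProj H :=
  minHilbert_regular.leftM_eq_trivialProj minHilbert_one fun _ _ => minHilbert_col_one_ne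

variable (H) in
theorem minHilbert_leftL : (minHilbert H).leftL = orthProj H := by
  refine Set.Subset.antisymm (minHilbert_regular.leftL_subset minHilbert_one) fun P hP => ?_
  refine ⟨(mem_orthProj_iff.1 hP).1, fun x => ?_⟩
  rw [minHilbert_one]
  refine le_antisymm ?_ ((colProj_splitMap_le minHilbert_regular minHilbert_le_columnHilbert hP
    (Matrix.of fun (_ _ : Unit) => x)).trans_eq (columnHilbert_one x))
  rcases eq_or_ne x 0 with rfl | hx
  · rw [norm_zero]
    exact (minHilbert_nonneg _).trans (minHilbert_regular.nrm_apply_le_colProj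
      (Matrix.of fun (_ _ : Unit) => splitMap P 0) 0)
  have hx0 : 0 < ‖x‖ := norm_pos_iff.2 hx
  have hs : ‖x‖ ^ 2 = ‖splitMap P x 0‖ ^ 2 + ‖splitMap P x 1‖ ^ 2 :=
    norm_sq_eq_add_of_mem_orthProj hP x
  -- Tested on the splitting itself, these functionals give `‖x‖²`, while their row bound is `√(‖P
  -- x‖² + ‖x - P x‖²) = ‖x‖`.
  have key := minHilbert_regular.norm_le_colProj_one
    (fun k => (innerSL ℂ (splitMap P x k)).toLinearMap) hx0 (fun y => ?_) (splitMap P x)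
  · have e : ∑ k, (innerSL ℂ (splitMap P x k)).toLinearMap (splitMap P x k) =
        ((‖x‖ ^ 2 : ℝ) : ℂ) := by
      rw [hs, Fin.sum_univ_two]
      push_cast
      exact congrArg₂ (· + ·) (inner_self_eq_norm_sq_to_K _) (inner_self_eq_norm_sq_to_K _)
    rw [e, Complex.norm_real, Real.norm_of_nonneg (by positivity), sq] at key
    exact le_of_mul_le_mul_left key hx0
  · have h1 := minHilbert_inner_row_le (splitMap P x) y
    rw [← hs, Real.sqrt_sq hx0.le] at h1
    exact h1

variable (H) in
theorem minHilbert_completeLeftL : (minHilbert H).completeLeftL = trivialProj H := by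
  refine minHilbert_regular.completeLeftL_eq_trivialProj (subset_trivialProj
    (minHilbert_regular.completeLeftL_subset.trans
      (minHilbert_regular.leftL_subset minHilbert_one)) ?_)
  rintro P ⟨-, hP⟩ u v hu hv h
  have hun : ‖u‖ = 1 := h.1 0
  have hvn : ‖v‖ = 1 := h.1 1
  -- The column with entries `u, v`, padded to a square matrix: contractive in `MIN(H)`, but its
  -- splitting maps to the column with entries `e₀, e₁`, of norm at least `√2`.
  set x : Matrix (Fin 2) (Fin 2) H := !![u, 0; v, 0]
  have h1 : (minHilbert H).nrm x ≤ 1 := by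
    refine minHilbert_le fun f hf => scalarOpNorm_le zero_le_one fun c => ?_
    have h2 := sum_norm_sq_dual_le hf h
    rw [Fin.sum_univ_two] at h2
    simp only [Matrix.cons_val_zero, Matrix.cons_val_one] at h2
    simp [x, Fin.sum_univ_two, mul_pow, ← add_mul]
    nlinarith [sq_nonneg ‖c 0‖, sq_nonneg ‖c 1‖]
  have h2 := columnHilbert_le_minHilbert_colProj h (x.map (splitMap P))
  rw [hP 2 x] at h2
  set y : Matrix (Fin 2) (Fin 2) (EuclideanSpace ℂ (Fin 2)) := Matrix.of fun i j =>
    ∑ k, inner ℂ (![u, v] k) (x.map (splitMap P) i j k) • EuclideanSpace.single k (1 : ℂ) with hy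
  have h3 := columnHilbert_bound y ![1, 0]
  have h4 := pow_le_one₀ (n := 2) (columnHilbert_nonneg _) (h2.trans h1)
  have hy0 : y 0 0 = EuclideanSpace.single 0 (1 : ℂ) := by
    simp [hy, Fin.sum_univ_two, x, splitMap, hu, hun]
  have hy1 : y 1 0 = EuclideanSpace.single 1 (1 : ℂ) := by
    simp [hy, Fin.sum_univ_two, x, splitMap, hv, hvn]
  simp [Fin.sum_univ_two, hy0, hy1] at h3
  norm_num at h3
  linarith

variable (H) in
theorem operatorHilbert_leftM : (operatorHilbert H).leftM = trivialProj H :=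
  operatorHilbert_regular.leftM_eq_trivialProj operatorHilbert_one
    fun _ _ => operatorHilbert_col_one_ne

variable (H) in
theorem operatorHilbert_leftL : (operatorHilbert H).leftL = trivialProj H :=
  operatorHilbert_regular.leftL_eq_trivialProj operatorHilbert_one
    fun _ _ => operatorHilbert_colProj_one_ne

end Hilbert

section Hilbert

variable {H : Type*} [NormedAddCommGroup H] [InnerProductSpace ℂ H]

/-! ### The maximal quantization -/

/-- A bound that does not depend on the structure `o`; without it the supremum defining `MAX(H)`
could be a default value. -/
theorem IsOperatorSpace.nrm_le_sum {o : MatrixNorms H} (h : o.IsOperatorSpace)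
    (h1 : ∀ ξ, o.one ξ = ‖ξ‖) {m n : Type} [Fintype m] [Fintype n] (x : Matrix m n H) :
    o.nrm x ≤ ∑ i, ∑ j, ‖x i j‖ := by
  classical
  have hsum : ∀ {ι : Type} [Fintype ι] (y : ι → Matrix m n H),
      o.nrm (∑ i, y i) ≤ ∑ i, o.nrm (y i) := fun y =>
    Finset.le_sum_of_subadditive o.nrm h.nrm_zero.le h.add_le _ _
  conv_lhs => rw [Matrix.matrix_eq_sum_single x]
  refine (hsum _).trans (Finset.sum_le_sum fun i _ => (hsum _).trans
    (Finset.sum_le_sum fun j _ => ?_))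
  have e : Matrix.single i j (x i j) = Matrix.bimul (selMatrix fun _ : Unit => i).transpose
      (Matrix.of fun (_ _ : Unit) => x i j) (selMatrix fun _ : Unit => j) := by
    ext k l
    by_cases hi : i = k <;> by_cases hj : j = l <;> simp [Matrix.bimul, selMatrix, hi, hj]
  rw [e, ← h1]
  exact h.regular.nrm_bimul_le _
    (scalarOpNorm_selMatrix_transpose_le (Function.injective_of_subsingleton _))
    (scalarOpNorm_selMatrix_le (Function.injective_of_subsingleton _))

theorem IsOperatorSpace.nrm_le_maxHilbert {o : MatrixNorms H} (h : o.IsOperatorSpace)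
    (h1 : ∀ ξ, o.one ξ = ‖ξ‖) {m n : Type} [Fintype m] [Fintype n] (x : Matrix m n H) :
    o.nrm x ≤ (maxHilbert H).nrm x := by
  refine le_csSup ⟨∑ i, ∑ j, ‖x i j‖, ?_⟩ ⟨o, h, h1, rfl⟩
  rintro _ ⟨o, h, h1, rfl⟩
  exact h.nrm_le_sum h1 x

theorem maxHilbert_le {m n : Type} [Fintype m] [Fintype n] {x : Matrix m n H} {C : ℝ}
    (h : ∀ o : MatrixNorms H, o.IsOperatorSpace → (∀ ξ, o.one ξ = ‖ξ‖) → o.nrm x ≤ C) :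
    (maxHilbert H).nrm x ≤ C := by
  refine csSup_le ⟨_, columnHilbert H, columnHilbert_isOperatorSpace, columnHilbert_one, rfl⟩ ?_
  rintro _ ⟨o, ho, h1, rfl⟩
  exact h o ho h1

theorem columnHilbert_le_maxHilbert {m n : Type} [Fintype m] [Fintype n] (x : Matrix m n H) :
    (columnHilbert H).nrm x ≤ (maxHilbert H).nrm x :=
  columnHilbert_isOperatorSpace.nrm_le_maxHilbert columnHilbert_one x

theorem rowHilbert_le_maxHilbert {m n : Type} [Fintype m] [Fintype n] (x : Matrix m n H) :
    (rowHilbert H).nrm x ≤ (maxHilbert H).nrm x :=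
  rowHilbert_isOperatorSpace.nrm_le_maxHilbert rowHilbert_one x

theorem maxHilbert_regular : (maxHilbert H).Regular where
  nonneg x := (columnHilbert_nonneg x).trans (columnHilbert_le_maxHilbert x)
  bimul_le α x β := by
    refine maxHilbert_le fun o ho h1 => (ho.bimul_le α x β).trans ?_
    have h2 := scalarOpNorm_nonneg α
    have h3 := scalarOpNorm_nonneg β
    gcongr
    exact ho.nrm_le_maxHilbert h1 x
  amp_le k x := maxHilbert_le fun o ho h1 =>
    (ho.regular.amp_le k x).trans (ho.nrm_le_maxHilbert h1 x)

theorem maxHilbert_one (ξ : H) : (maxHilbert H).one ξ = ‖ξ‖ :=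
  le_antisymm (maxHilbert_le fun _ _ h1 => (h1 ξ).le)
    ((columnHilbert_one ξ).symm.trans_le (columnHilbert_le_maxHilbert _))

theorem maxHilbert_transpose_le {m n : Type} [Fintype m] [Fintype n] (x : Matrix m n H) :
    (maxHilbert H).nrm x.transpose ≤ (maxHilbert H).nrm x :=
  maxHilbert_le fun _ ho h1 => ho.op.nrm_le_maxHilbert h1 x

variable (H) in
theorem maxHilbert_op : (maxHilbert H).op = maxHilbert H := by
  refine congrArg MatrixNorms.mk ?_
  funext m n _ _ x
  exact le_antisymm (maxHilbert_transpose_le x) (maxHilbert_transpose_le x.transpose)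

theorem IsOperatorSpace.nrm_diag_le {o : MatrixNorms H} (h : o.IsOperatorSpace)
    (h1 : ∀ ξ, o.one ξ = ‖ξ‖) {u v : H} (hu : ‖u‖ ≤ 1) (hv : ‖v‖ ≤ 1) :
    o.nrm (Matrix.fromBlocks (Matrix.of fun (_ _ : Unit) => u) 0 0
      (Matrix.of fun (_ _ : Unit) => v)) ≤ 1 := by
  rw [h.directSum]
  exact max_le ((h1 u).trans_le hu) ((h1 v).trans_le hv)

theorem IsOperatorSpace.col_one_le {o : MatrixNorms H} (h : o.IsOperatorSpace)
    (h1 : ∀ ξ, o.one ξ = ‖ξ‖) (a b : H) : o.col.one ![a, b] ≤ √(‖a‖ ^ 2 + ‖b‖ ^ 2) := by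
  -- For `a = 0` the convention `0⁻¹ = 0` makes the normalized vector `0`, so no case is lost.
  have hu : ∀ a : H, ‖(‖a‖⁻¹ : ℂ) • a‖ ≤ 1 := fun a => by
    rcases eq_or_ne a 0 with rfl | ha
    · simp
    · simp [norm_smul, ha]
  have hs : ∀ a : H, ‖a‖ • (‖a‖⁻¹ : ℂ) • a = a := fun a => by
    rcases eq_or_ne a 0 with rfl | ha
    · simp
    · rw [← Complex.coe_smul]
      exact smul_inv_smul₀ (by exact_mod_cast norm_ne_zero_iff.2 ha) a
  let f : Unit × Fin 2 → Unit ⊕ Unit := fun i => if i.2 = 0 then Sum.inl () else Sum.inr ()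
  have hf : Function.Injective f := by decide
  let β : Matrix (Unit ⊕ Unit) Unit ℂ :=
    Matrix.of fun i _ => Sum.elim (fun _ => (‖a‖ : ℂ)) (fun _ => (‖b‖ : ℂ)) i
  have hβ : scalarOpNorm β ≤ √(‖a‖ ^ 2 + ‖b‖ ^ 2) := by
    refine scalarOpNorm_le (by positivity) fun c => ?_
    rw [Real.sq_sqrt (by positivity)]
    simp [β, mul_pow, add_mul]
  -- The column is `diag(a/‖a‖, b/‖b‖)` times the scalar column `(‖a‖, ‖b‖)`. Only the diagonal
  -- involves the structure, and its norm is determined by the norm of `H`.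
  have e : (Matrix.of fun (i : Unit × Fin 2) (_ : Unit) => ![a, b] i.2) =
      Matrix.bimul (selMatrix f) (Matrix.fromBlocks
        (Matrix.of fun (_ _ : Unit) => (‖a‖⁻¹ : ℂ) • a) 0 0
        (Matrix.of fun (_ _ : Unit) => (‖b‖⁻¹ : ℂ) • b)) β := by
    ext ⟨i, k⟩ j
    fin_cases k <;> simp [Matrix.bimul, selMatrix, f, β, hs]
  change o.nrm (Matrix.of fun (i : Unit × Fin 2) (_ : Unit) => ![a, b] i.2) ≤ _
  rw [e]
  refine (h.bimul_le _ _ _).trans ?_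
  have h2 := h.nrm_diag_le h1 (hu a) (hu b)
  calc _ ≤ 1 * 1 * √(‖a‖ ^ 2 + ‖b‖ ^ 2) :=
        mul_le_mul (mul_le_mul (scalarOpNorm_selMatrix_le hf) h2 (h.nonneg _) zero_le_one) hβ
          (scalarOpNorm_nonneg β) (by norm_num)
    _ = _ := by ring

variable [CompleteSpace H]

variable (H) in
theorem maxHilbert_leftM : (maxHilbert H).leftM = orthProj H := by
  refine Set.Subset.antisymm (maxHilbert_regular.leftM_subset maxHilbert_one) fun P hP => ?_
  refine ⟨(mem_orthProj_iff.1 hP).1, fun x => ?_⟩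
  rw [maxHilbert_one]
  refine le_antisymm ?_ (maxHilbert_le fun o ho h1 => (ho.col_one_le h1 _ _).trans_eq ?_)
  · have h1 := columnHilbert_col_splitMap hP (Matrix.of fun (_ _ : Unit) => x)
    have h2 := columnHilbert_le_maxHilbert
      (Matrix.of fun (i : Unit × Fin 2) (_ : Unit) => splitMap P x i.2)
    have h3 : (columnHilbert H).nrm
        (Matrix.of fun (i : Unit × Fin 2) (_ : Unit) => splitMap P x i.2) = ‖x‖ :=
      Eq.trans h1 (columnHilbert_one x)
    rw [← h3]
    exact h2
  · rw [← norm_sq_eq_add_of_mem_orthProj hP, Real.sqrt_sq (norm_nonneg x)]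

variable (H) in
theorem maxHilbert_leftL : (maxHilbert H).leftL = trivialProj H :=
  maxHilbert_regular.leftL_eq_trivialProj maxHilbert_one fun _ _ h =>
    two_ne_sqrt_two_of_le (two_le_colProj_one maxHilbert_regular rowHilbert_le_maxHilbert h)

variable (H) in
theorem maxHilbert_completeLeftM : (maxHilbert H).completeLeftM = trivialProj H := by
  refine maxHilbert_regular.completeLeftM_eq_trivialProj (subset_trivialProj
    (maxHilbert_regular.completeLeftM_subset.trans
      (maxHilbert_regular.leftM_subset maxHilbert_one)) ?_)
  intro P hP u v hu hv h
  have hun : ‖u‖ = 1 := h.1 0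
  have hvn : ‖v‖ = 1 := h.1 1
  -- The row `[u v]`, padded to a square matrix. Its splitting has `u` and `v` in different rows and
  -- columns, so it is a compression of `diag(u, v)`, while the row norm of `x` is at least `√2`.
  let x : Matrix (Fin 2) (Fin 2) H := !![u, v; 0, 0]
  have h1 := (hP 2).2 x
  have h2 : ((maxHilbert H).amplify 2).col.one (splitMap P.mapMatrix x) ≤ 1 := by
    refine maxHilbert_le fun o ho ho1 => ?_
    let f : Unit ⊕ Unit → (Unit × Fin 2) × Fin 2 :=
      Sum.elim (fun _ => (((), 0), 0)) (fun _ => (((), 1), 0))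
    let g : Unit ⊕ Unit → Unit × Fin 2 := Sum.elim (fun _ => ((), 0)) (fun _ => ((), 1))
    have hf : Function.Injective f := by decide
    have hg : Function.Injective g := by decide
    refine le_trans (le_of_eq_of_le (congrArg o.nrm ?_) (ho.regular.nrm_bimul_le
      (Matrix.fromBlocks (Matrix.of fun (_ _ : Unit) => u) 0 0 (Matrix.of fun (_ _ : Unit) => v))
      (scalarOpNorm_selMatrix_transpose_le hf) (scalarOpNorm_selMatrix_le hg)))
      (ho.nrm_diag_le ho1 hun.le hvn.le)
    ext ⟨⟨i, k⟩, a⟩ ⟨j, b⟩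
    fin_cases k <;> fin_cases a <;> fin_cases b <;>
      simp [Matrix.bimul, selMatrix, f, g, splitMap, x, hu, hv]
  have h3 : 2 ≤ (((maxHilbert H).amplify 2).one x) ^ 2 := by
    have h4 := rowHilbert_le_maxHilbert
      (Matrix.comp Unit Unit (Fin 2) (Fin 2) H (Matrix.of fun _ _ => x))
    have h5 := columnHilbert_bound
      (Matrix.comp Unit Unit (Fin 2) (Fin 2) H (Matrix.of fun _ _ => x)).transpose
      fun i => if i.2 = 0 then 1 else 0
    have h6 := (le_rowHilbert_nrm _).trans h4
    simp [Fintype.sum_prod_type, x, hun, hvn] at h5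
    norm_num at h5
    exact h5.trans (pow_le_pow_left₀ (columnHilbert_nonneg _) h6 2)
  rw [h1] at h3
  have h7 : 0 ≤ ((maxHilbert H).amplify 2).col.one (splitMap P.mapMatrix x) :=
    maxHilbert_regular.nonneg _
  nlinarith

end Hilbert

end MatrixNorms

theorem proposition6p10 {H : Type*} [NormedAddCommGroup H] [InnerProductSpace ℂ H]
    [CompleteSpace H] :
    -- the five rows of the table: left M, right L, right M, left L
    ((MatrixNorms.columnHilbert H).leftM = MatrixNorms.orthProj H ∧
      (MatrixNorms.columnHilbert H).rightL = MatrixNorms.trivialProj H ∧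
      (MatrixNorms.columnHilbert H).rightM = MatrixNorms.trivialProj H ∧
      (MatrixNorms.columnHilbert H).leftL = MatrixNorms.orthProj H) ∧
    ((MatrixNorms.rowHilbert H).leftM = MatrixNorms.trivialProj H ∧
      (MatrixNorms.rowHilbert H).rightL = MatrixNorms.orthProj H ∧
      (MatrixNorms.rowHilbert H).rightM = MatrixNorms.orthProj H ∧
      (MatrixNorms.rowHilbert H).leftL = MatrixNorms.trivialProj H) ∧
    ((MatrixNorms.operatorHilbert H).leftM = MatrixNorms.trivialProj H ∧
      (MatrixNorms.operatorHilbert H).rightL = MatrixNorms.trivialProj H ∧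
      (MatrixNorms.operatorHilbert H).rightM = MatrixNorms.trivialProj H ∧
      (MatrixNorms.operatorHilbert H).leftL = MatrixNorms.trivialProj H) ∧
    ((MatrixNorms.minHilbert H).leftM = MatrixNorms.trivialProj H ∧
      (MatrixNorms.minHilbert H).rightL = MatrixNorms.orthProj H ∧
      (MatrixNorms.minHilbert H).rightM = MatrixNorms.trivialProj H ∧
      (MatrixNorms.minHilbert H).leftL = MatrixNorms.orthProj H) ∧
    ((MatrixNorms.maxHilbert H).leftM = MatrixNorms.orthProj H ∧
      (MatrixNorms.maxHilbert H).rightL = MatrixNorms.trivialProj H ∧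
      (MatrixNorms.maxHilbert H).rightM = MatrixNorms.orthProj H ∧
      (MatrixNorms.maxHilbert H).leftL = MatrixNorms.trivialProj H) ∧
    -- the first three rows for the complete projections
    ((MatrixNorms.columnHilbert H).completeLeftM = MatrixNorms.orthProj H ∧
      (MatrixNorms.columnHilbert H).completeRightL = MatrixNorms.trivialProj H ∧
      (MatrixNorms.columnHilbert H).completeRightM = MatrixNorms.trivialProj H ∧
      (MatrixNorms.columnHilbert H).completeLeftL = MatrixNorms.orthProj H) ∧
    ((MatrixNorms.rowHilbert H).completeLeftM = MatrixNorms.trivialProj H ∧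
      (MatrixNorms.rowHilbert H).completeRightL = MatrixNorms.orthProj H ∧
      (MatrixNorms.rowHilbert H).completeRightM = MatrixNorms.orthProj H ∧
      (MatrixNorms.rowHilbert H).completeLeftL = MatrixNorms.trivialProj H) ∧
    ((MatrixNorms.operatorHilbert H).completeLeftM = MatrixNorms.trivialProj H ∧
      (MatrixNorms.operatorHilbert H).completeRightL = MatrixNorms.trivialProj H ∧
      (MatrixNorms.operatorHilbert H).completeRightM = MatrixNorms.trivialProj H ∧
      (MatrixNorms.operatorHilbert H).completeLeftL = MatrixNorms.trivialProj H) ∧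
    -- `MAX(H)` and `MIN(H)` for the complete projections
    ((MatrixNorms.maxHilbert H).completeLeftM = MatrixNorms.trivialProj H ∧
      (MatrixNorms.maxHilbert H).completeRightM = MatrixNorms.trivialProj H) ∧
    ((MatrixNorms.minHilbert H).completeLeftL = MatrixNorms.trivialProj H ∧
      (MatrixNorms.minHilbert H).completeRightL = MatrixNorms.trivialProj H) := by
  have hr := (MatrixNorms.rowHilbert_isOperatorSpace (H := H)).regular
  have ho := MatrixNorms.operatorHilbert_regular (H := H)
  have rowM := hr.completeLeftM_eq_trivialProj
    (hr.completeLeftM_subset.trans (MatrixNorms.rowHilbert_leftM H).subset)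
  have rowL := hr.completeLeftL_eq_trivialProj
    (hr.completeLeftL_subset.trans (MatrixNorms.rowHilbert_leftL H).subset)
  have opM := ho.completeLeftM_eq_trivialProj
    (ho.completeLeftM_subset.trans (MatrixNorms.operatorHilbert_leftM H).subset)
  have opL := ho.completeLeftL_eq_trivialProj
    (ho.completeLeftL_subset.trans (MatrixNorms.operatorHilbert_leftL H).subset)
  -- Every right-handed entry becomes the left-handed entry of the opposite structure, leaving only
  -- the left projections.
  simp only [← MatrixNorms.op_leftM, ← MatrixNorms.op_leftL, ← MatrixNorms.op_completeLeftM,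
    ← MatrixNorms.op_completeLeftL, MatrixNorms.columnHilbert_op, MatrixNorms.rowHilbert_op,
    MatrixNorms.operatorHilbert_op, MatrixNorms.minHilbert_op, MatrixNorms.maxHilbert_op,
    MatrixNorms.columnHilbert_leftM, MatrixNorms.columnHilbert_leftL,
    MatrixNorms.columnHilbert_completeLeftM, MatrixNorms.columnHilbert_completeLeftL,
    MatrixNorms.rowHilbert_leftM, MatrixNorms.rowHilbert_leftL, rowM, rowL,
    MatrixNorms.operatorHilbert_leftM, MatrixNorms.operatorHilbert_leftL, opM, opL,
    MatrixNorms.minHilbert_leftM, MatrixNorms.minHilbert_leftL,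
    MatrixNorms.minHilbert_completeLeftL, MatrixNorms.maxHilbert_leftM,
    MatrixNorms.maxHilbert_leftL, MatrixNorms.maxHilbert_completeLeftM, and_self]
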